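/- Let $(G_n)_{n\in I}$ be a family of finite simple connected graphs all of whose vertex degrees lie between $3$ and a fixed number $d$ (for instance $d$-regular graphs with fixed $d\ge 3$), with girth diverging as the number $|V(G_n)|$ of vertices tends to infinity: for every $g$ there is $N_0$ such that every $G_n$ with $|V(G_n)|\ge N_0$ has girth at least $g$. For a graph $G$, let $G\times G$ be the square $2$-complex whose $0$-cells are pairs of vertices, whose $1$-cells are the pairs (edge, vertex) and (vertex, edge), and whose $2$-cells (plaquettes) are the pairs of edges. Put a spin-$1/2$ (a copy of $\mathbb C^2$) on every $1$-cell. For a $0$-cell $s$ let $A_s=\prod_{e:\, s\in\partial e}S^x_e$, for a $2$-cell $p$ let $B_p=\prod_{e\in\partial p}S^z_e$, where $S^x_e,S^z_e$ are the Pauli matrices acting on the spin at $e$, and put $B=-\sum_p B_p$. Let $N_p$ be the number of $2$-cells. The distance between $1$-cells is the path metric in which two distinct $1$-cells attached to a common $0$-cell have distance $1$. A unitary quantum circuit is a product $U=U_1\cdots U_k$ of rounds, each round $U_i$ being a product of unitaries $U_{i,a}$ with pairwise disjoint supports; its range is the depth $k$ times the maximal diameter of the support of a $U_{i,a}$. A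 unit vector $\psi$ is $R$-trivial if $\psi=U\psi_{prod}$ for some product state $\psi_{prod}$ and some unitary quantum circuit $U$ of range at most $R$. Then there is an $\epsilon>0$ such that for every $R<\infty$ there is $N_0$ such that for every $G=G_n$ in the family with $|V(G)|\ge N_0$ there is no $R$-trivial state $\psi$ on $G\times G$ with $|\psi|=1$, with $A_s\psi=\psi$ for all $0$-cells $s$, and with $$\langle\psi,B\psi\rangle<-(1-\epsilon)N_p .$$ -/

import Mathlib

/-! ### Many-spin systems: states, operators and supports -/

/-- The Hilbert space of a system of spins-1/2, one for each element of `Q`: it is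
`⨂_{q ∈ Q} ℂ²`, with orthonormal basis the configurations `Q → Fin 2`. -/
abbrev SpinSpace (Q : Type*) : Type _ := EuclideanSpace ℂ (Q → Fin 2)

/-- Operators on `SpinSpace Q`, written as matrices in the configuration basis. -/
abbrev SpinOp (Q : Type*) : Type _ := Matrix (Q → Fin 2) (Q → Fin 2) ℂ

/-- The action of an operator on a state. -/
noncomputable def SpinOp.app {Q : Type*} [Fintype Q] [DecidableEq Q]
    (T : SpinOp Q) (ψ : SpinSpace Q) : SpinSpace Q :=
  Matrix.toEuclideanLin T ψ

/-- The tensor product `⨂_q M_q` of one-spin operators. -/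
def tensorOp {Q : Type*} [Fintype Q] (M : Q → Matrix (Fin 2) (Fin 2) ℂ) : SpinOp Q :=
  fun σ τ => ∏ q, M q (σ q) (τ q)

theorem tensorOp_one {Q : Type*} [Fintype Q] [DecidableEq Q] :
    tensorOp (1 : Q → Matrix (Fin 2) (Fin 2) ℂ) = 1 := by
  ext σ τ
  by_cases h : σ = τ
  · subst h
    simp [tensorOp]
  · obtain ⟨q, hq⟩ := Function.ne_iff.mp h
    rw [Matrix.one_apply_ne h]
    exact Finset.prod_eq_zero (Finset.mem_univ q) (by simp [Matrix.one_apply_ne hq])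

theorem tensorOp_mul {Q : Type*} [Fintype Q] [DecidableEq Q]
    (M N : Q → Matrix (Fin 2) (Fin 2) ℂ) :
    tensorOp (M * N) = tensorOp M * tensorOp N := by
  ext σ τ
  simp only [tensorOp, Pi.mul_apply, Matrix.mul_apply, ← Finset.prod_mul_distrib]
  rw [Finset.prod_univ_sum]
  simp

/-- The one-spin operator `m` acting on the spin `q`, tensored with the identity elsewhere. -/
def siteOp {Q : Type*} [Fintype Q] [DecidableEq Q]
    (q : Q) (m : Matrix (Fin 2) (Fin 2) ℂ) : SpinOp Q :=
  tensorOp (Pi.mulSingle q m)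

/-- The spin operator `S^x_q` (Pauli matrix). -/
def spinX {Q : Type*} [Fintype Q] [DecidableEq Q] (q : Q) : SpinOp Q :=
  siteOp q !![0, 1; 1, 0]

/-- The spin operator `S^z_q` (Pauli matrix). -/
def spinZ {Q : Type*} [Fintype Q] [DecidableEq Q] (q : Q) : SpinOp Q :=
  siteOp q !![1, 0; 0, -1]

theorem siteOp_commute {Q : Type*} [Fintype Q] [DecidableEq Q]
    (m : Matrix (Fin 2) (Fin 2) ℂ) (q r : Q) : Commute (siteOp q m) (siteOp r m) := by
  rcases eq_or_ne q r with rfl | h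
  · exact Commute.refl _
  · have hc := Pi.mulSingle_commute (f := fun _ : Q => Matrix (Fin 2) (Fin 2) ℂ) h m m
    unfold siteOp
    rw [commute_iff_eq, ← tensorOp_mul, ← tensorOp_mul, hc.eq]

/-- The product of the (commuting) operators `S^x_q` over `q ∈ S`. -/
noncomputable def prodX {Q : Type*} [Fintype Q] [DecidableEq Q] (S : Finset Q) : SpinOp Q :=
  S.noncommProd spinX fun q _ r _ _ => siteOp_commute _ q r

/-- The product of the (commuting) operators `S^z_q` over `q ∈ S`. -/
noncomputable def prodZ {Q : Type*} [Fintype Q] [DecidableEq Q] (S : Finset Q) : SpinOp Q :=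
  S.noncommProd spinZ fun q _ r _ _ => siteOp_commute _ q r

/-- `T` is of the form `M ⊗ 1`, with `M` acting on the spins in `S` and the identity acting on
all other spins. -/
def SpinOp.IsSupportedOn {Q : Type*} (T : SpinOp Q) (S : Finset Q) : Prop :=
  ∃ M : Matrix (S → Fin 2) (S → Fin 2) ℂ, ∀ σ τ : Q → Fin 2,
    ((∀ q, q ∉ S → σ q = τ q) → T σ τ = M (fun q => σ q) (fun q => τ q)) ∧
    (¬ (∀ q, q ∉ S → σ q = τ q) → T σ τ = 0)

/-- `ξ` is a product state `⨂_q v_q` of unit vectors `v_q ∈ ℂ²`. -/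
def IsProductState {Q : Type*} [Fintype Q] (ξ : SpinSpace Q) : Prop :=
  ∃ v : Q → EuclideanSpace ℂ (Fin 2), (∀ q, ‖v q‖ = 1) ∧ ∀ σ : Q → Fin 2, ξ σ = ∏ q, v q (σ q)

/-! ### Quantum circuits and trivial states

Distances between spins are graph distances in a graph `Λ` whose vertices are the spins. -/

/-- A unitary together with a set of spins on which it is supported. -/
structure Gate (Q : Type*) [Fintype Q] [DecidableEq Q] where
  op : SpinOp Q
  unitary : op ∈ Matrix.unitaryGroup (Q → Fin 2) ℂ
  sites : Finset Q
  supported : op.IsSupportedOn sites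

/-- A round of a circuit: finitely many gates with pairwise disjoint supports. -/
structure Round (Q : Type*) [Fintype Q] [DecidableEq Q] where
  gates : List (Gate Q)
  disjoint : gates.Pairwise fun a b => Disjoint a.sites b.sites

/-- The unitary `U_i = U_{i,1} ⋯ U_{i,n_i}` of a round. -/
def Round.op {Q : Type*} [Fintype Q] [DecidableEq Q] (L : Round Q) : SpinOp Q :=
  (L.gates.map Gate.op).prod

/-- A unitary quantum circuit: a finite sequence of rounds. -/
structure Circuit (Q : Type*) [Fintype Q] [DecidableEq Q] where
  rounds : List (Round Q)

/-- The unitary `U = U_1 ⋯ U_k` of a circuit. -/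
def Circuit.op {Q : Type*} [Fintype Q] [DecidableEq Q] (c : Circuit Q) : SpinOp Q :=
  (c.rounds.map Round.op).prod

/-- The number of rounds of a circuit. -/
def Circuit.depth {Q : Type*} [Fintype Q] [DecidableEq Q] (c : Circuit Q) : ℕ :=
  c.rounds.length

/-- The diameter of a set of spins (`0` for the empty set, `⊤` if it meets two components). -/
noncomputable def setDiam {Q : Type*} (Λ : SimpleGraph Q) (S : Finset Q) : ℕ∞ :=
  ⨆ x ∈ S, ⨆ y ∈ S, Λ.edist x y

/-- The maximum of the ranges of the gates of a circuit, where the range of a gate is the diameter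
of its support (`0` if there are no gates). -/
noncomputable def Circuit.gateRange {Q : Type*} [Fintype Q] [DecidableEq Q]
    (Λ : SimpleGraph Q) (c : Circuit Q) : ℕ∞ :=
  ⨆ L ∈ c.rounds, ⨆ a ∈ L.gates, setDiam Λ a.sites

/-- The range of a circuit: depth times the maximal range of its gates. -/
noncomputable def Circuit.range {Q : Type*} [Fintype Q] [DecidableEq Q]
    (Λ : SimpleGraph Q) (c : Circuit Q) : ℕ∞ :=
  c.depth * c.gateRange Λ

/-- `ψ` is `(R, ε)`-trivial: it is a unit vector within distance `ε` of a state that a circuit of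
range at most `R` makes from a product state. -/
def IsApproxTrivial {Q : Type*} [Fintype Q] [DecidableEq Q] (Λ : SimpleGraph Q)
    (R : ℕ) (ε : ℝ) (ψ : SpinSpace Q) : Prop :=
  ‖ψ‖ = 1 ∧ ∃ (c : Circuit Q) (ξ : SpinSpace Q),
    c.range Λ ≤ (R : ℕ∞) ∧ IsProductState ξ ∧ ‖ψ - c.op.app ξ‖ ≤ ε

/-- `ψ` is `R`-trivial, that is, `(R, 0)`-trivial. -/
def IsTrivialState {Q : Type*} [Fintype Q] [DecidableEq Q] (Λ : SimpleGraph Q)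
    (R : ℕ) (ψ : SpinSpace Q) : Prop :=
  IsApproxTrivial Λ R 0 ψ

/-! ### The square complex `G × G` and its toric code -/

/-- The `0`-cells of `G × G`. -/
abbrev ZeroCell {V : Type*} (_G : SimpleGraph V) : Type _ := V × V

/-- The `1`-cells of `G × G`: edge × vertex (`Sum.inl`) or vertex × edge (`Sum.inr`). -/
abbrev OneCell {V : Type*} (G : SimpleGraph V) : Type _ := (G.edgeSet × V) ⊕ (V × G.edgeSet)

/-- The `2`-cells (plaquettes) of `G × G`: edge × edge. -/
abbrev TwoCell {V : Type*} (G : SimpleGraph V) : Type _ := G.edgeSet × G.edgeSet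

/-- The endpoints (as a set of `0`-cells) of a `1`-cell. -/
def OneCell.ends {V : Type*} [Fintype V] [DecidableEq V] (G : SimpleGraph V) :
    OneCell G → Finset (ZeroCell G)
  | Sum.inl (e, i) => Finset.univ.filter fun s => s.1 ∈ (e : Sym2 V) ∧ s.2 = i
  | Sum.inr (i, e) => Finset.univ.filter fun s => s.1 = i ∧ s.2 ∈ (e : Sym2 V)

/-- The `1`-cells attached to a `0`-cell. -/
def ZeroCell.star {V : Type*} [Fintype V] [DecidableEq V] (G : SimpleGraph V)
    [DecidableRel G.Adj] (s : ZeroCell G) : Finset (OneCell G) :=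
  Finset.univ.filter fun e => s ∈ OneCell.ends G e

/-- The four `1`-cells in the boundary of the square `e × f`: `e × {i}` for the endpoints `i`
of `f`, and `{j} × f` for the endpoints `j` of `e`. -/
def TwoCell.boundary {V : Type*} [Fintype V] [DecidableEq V] (G : SimpleGraph V)
    (p : TwoCell G) : Finset (OneCell G) :=
  (({p.1} : Finset G.edgeSet) ×ˢ Finset.univ.filter fun i : V => i ∈ (p.2 : Sym2 V)).disjSum
    ((Finset.univ.filter fun j : V => j ∈ (p.1 : Sym2 V)) ×ˢ ({p.2} : Finset G.edgeSet))

/-- The graph giving the metric on the `1`-cells of `G × G`: two distinct `1`-cells are at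
distance `1` when they are attached to a common `0`-cell. -/
def cellGraph {V : Type*} [Fintype V] [DecidableEq V] (G : SimpleGraph V) :
    SimpleGraph (OneCell G) where
  Adj c c' := c ≠ c' ∧ ∃ s, s ∈ OneCell.ends G c ∧ s ∈ OneCell.ends G c'
  symm := ⟨fun _ _ h => ⟨h.1.symm, h.2.imp fun _ hs => ⟨hs.2, hs.1⟩⟩⟩
  loopless := ⟨fun _ h => h.1 rfl⟩

/-- The vertex term `A_s`, the product of `S^x_e` over the `1`-cells `e` attached to `s`. -/
noncomputable def vertexTerm {V : Type*} [Fintype V] [DecidableEq V] (G : SimpleGraph V)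
    [DecidableRel G.Adj] (s : ZeroCell G) : SpinOp (OneCell G) :=
  prodX (ZeroCell.star G s)

/-- The plaquette term `B_p`, the product of `S^z_e` over the `1`-cells `e` in the boundary
of `p`. -/
noncomputable def plaquetteTerm {V : Type*} [Fintype V] [DecidableEq V] (G : SimpleGraph V)
    [DecidableRel G.Adj] (p : TwoCell G) : SpinOp (OneCell G) :=
  prodZ (TwoCell.boundary G p)

/-- The plaquette part `B = - ∑_p B_p` of the toric code Hamiltonian. -/
noncomputable def plaquetteHamiltonian {V : Type*} [Fintype V] [DecidableEq V]
    (G : SimpleGraph V) [DecidableRel G.Adj] : SpinOp (OneCell G) :=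
  - ∑ p : TwoCell G, plaquetteTerm G p

/-! In the `S^z` basis a configuration is a `ℤ/2`-valued 1-cochain of `G × G`, and its restriction
to `G × {v}` has a class in `H¹(G; ℤ/2)`. By `edgeClass_add_edgeClass`, the classes at the two ends
of an edge `f` differ by the class of the set of violated plaquettes over `f`. At low energy this
difference is, for most `f` and with high probability, one of the few classes with a light
representative (`card_good_edges`).

On the other hand the class over each `v` is exactly uniform (`prob_edgeClass`). Indeed a product of
vertex terms shifts the spins on `e × V` together with spins far away, and it has expectation one.
Correlations factorize in a trivial state (`IsTrivialState.expect_mul`), so `|ψ|` is invariant under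
the shift on `e × V` alone.

These two facts are compatible: the class could be random but the same over all `v`. The
contradiction comes from covers. Choose a permutation of `N` sheets for each edge of the second
factor. The girth is large, so the resulting cover is trivial over every light cone. The circuit
therefore lifts, and the lifted state looks locally like `N` independent copies of `ψ`
(`exists_prob_lift`). Chebyshev's inequality then yields one configuration of the lift, that is, a
labelling of the vertices of the cover by `H¹` that is nearly equidistributed over each vertex and
changes by light classes at most places over each good edge (`exists_labelling`).

Every lift has such a labelling, but there are too many lifts. Let `F` be the set of good edges, `Y`
the set of light classes and `M = |H¹|`. There are `(N!) ^ |F|` choices of permutations and at most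
`M ^ (N |V|)` labellings. By equidistribution a labelling leaves each sheet only `2 N |Y| / M`
partners along a good edge, except at `N / 16` places (`factorial_pow_le`). Since all degrees are at
least three, `|V| ≤ 2 |E| / 3` and `M ≥ 2 ^ (|E| / 3)`, and the count fails (`not_pow_le`). -/

/-! ### Supports of operators -/

/-- `T` acts on the spins in `S` only: its entries are invariant under simultaneous shifts away
from `S`, and vanish between configurations that differ away from `S`. -/
def SpinOp.ActsOn {Q : Type*} (S : Set Q) (T : SpinOp Q) : Prop :=
  (∀ χ : Q → Fin 2, (∀ q ∈ S, χ q = 0) → ∀ σ τ, T (σ + χ) (τ + χ) = T σ τ) ∧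
    ∀ σ τ : Q → Fin 2, ∀ q, q ∉ S → σ q ≠ τ q → T σ τ = 0

theorem SpinOp.IsSupportedOn.actsOn {Q : Type*} {T : SpinOp Q} {S : Finset Q}
    (h : T.IsSupportedOn S) : T.ActsOn (S : Set Q) := by
  obtain ⟨M, hM⟩ := h
  constructor
  · intro χ hχ σ τ
    by_cases hst : ∀ q, q ∉ S → σ q = τ q
    · rw [(hM σ τ).1 hst, (hM _ _).1 (fun q hq => by simp [hst q hq])]
      congr 1 <;> funext q <;> simp [hχ q q.2]
    · rw [(hM σ τ).2 hst, (hM _ _).2 (fun h' => hst fun q hq => by simpa using h' q hq)]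
  · intro σ τ q hq hne
    exact (hM σ τ).2 fun h => hne (h q (by simpa using hq))

namespace SpinOp.ActsOn

variable {Q : Type*} {S S' : Set Q} {T T' : SpinOp Q}

theorem mono (h : T.ActsOn S) (hS : S ⊆ S') : T.ActsOn S' :=
  ⟨fun χ hχ => h.1 χ fun q hq => hχ q (hS hq), fun σ τ q hq => h.2 σ τ q fun h' => hq (hS h')⟩

theorem conjTranspose (h : T.ActsOn S) : SpinOp.ActsOn S T.conjTranspose := by
  refine ⟨fun χ hχ σ τ => ?_, fun σ τ q hq hne => ?_⟩
  · simp only [Matrix.conjTranspose_apply, h.1 χ hχ τ σ]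
  · simp only [Matrix.conjTranspose_apply, h.2 τ σ q hq hne.symm, star_zero]

theorem diagonal [Fintype Q] [DecidableEq Q] {f : (Q → Fin 2) → ℂ}
    (hf : ∀ χ : Q → Fin 2, (∀ q ∈ S, χ q = 0) → ∀ σ, f (σ + χ) = f σ) :
    SpinOp.ActsOn S (Matrix.diagonal f) := by
  refine ⟨fun χ hχ σ τ => ?_, fun σ τ q _ hne => ?_⟩
  · by_cases h : σ = τ
    · subst h
      simp [hf χ hχ]
    · rw [Matrix.diagonal_apply_ne _ h, Matrix.diagonal_apply_ne _ (by simpa using h)]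
  · exact Matrix.diagonal_apply_ne _ fun h => hne (congrFun h q)

theorem one [Fintype Q] [DecidableEq Q] : SpinOp.ActsOn S (1 : SpinOp Q) := by
  rw [← Matrix.diagonal_one]
  exact diagonal fun _ _ _ => rfl

theorem mul [Fintype Q] [DecidableEq Q] (h : T.ActsOn S) (h' : T'.ActsOn S) :
    SpinOp.ActsOn S (T * T') := by
  refine ⟨fun χ hχ σ τ => ?_, fun σ τ q hq hne => ?_⟩
  · simp only [Matrix.mul_apply]
    rw [← Equiv.sum_comp (Equiv.addRight χ)]
    exact Finset.sum_congr rfl fun ρ _ => by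
      simp only [Equiv.coe_addRight, h.1 χ hχ, h'.1 χ hχ]
  · rw [Matrix.mul_apply]
    refine Finset.sum_eq_zero fun ρ _ => ?_
    by_cases hr : σ q = ρ q
    · rw [h'.2 ρ τ q hq (hr ▸ hne), mul_zero]
    · rw [h.2 σ ρ q hq hr, zero_mul]

-- Only one intermediate configuration contributes to each product: it agrees with one index on `S`
-- and with the other off `S`. Shift invariance then matches the factors of the two products.
open Classical in
theorem commute [Fintype Q] [DecidableEq Q] (h : T.ActsOn S) (h' : T'.ActsOn S')
    (hd : Disjoint S S') : T * T' = T' * T := by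
  have hS : ∀ q ∈ S, q ∉ S' := fun q hq hq' => Set.disjoint_left.mp hd hq hq'
  ext σ τ
  rw [Matrix.mul_apply, Matrix.mul_apply]
  rw [Finset.sum_eq_single (fun q => if q ∈ S then τ q else σ q),
    Finset.sum_eq_single (fun q => if q ∈ S then σ q else τ q)]
  · rw [mul_comm]
    congr 1
    · rw [← h'.1 (fun q => if q ∈ S then τ q - σ q else 0)
        (fun q hq => if_neg fun h => hS q h hq) σ]
      congr 1 <;> funext q <;> by_cases hq : q ∈ S <;> simp [hq]
    · rw [← h.1 (fun q => if q ∈ S then 0 else τ q - σ q) (fun q hq => if_pos hq) σ]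
      congr 1 <;> funext q <;> by_cases hq : q ∈ S <;> simp [hq]
  · intro ρ _ hρ
    obtain ⟨q, hq⟩ := Function.ne_iff.mp hρ
    by_cases hqS : q ∈ S
    · rw [h'.2 σ ρ q (hS q hqS) (by simpa [hqS] using Ne.symm hq), zero_mul]
    · rw [h.2 ρ τ q hqS (by simpa [hqS] using hq), mul_zero]
  · simp
  · intro ρ _ hρ
    obtain ⟨q, hq⟩ := Function.ne_iff.mp hρ
    by_cases hqS : q ∈ S
    · rw [h'.2 ρ τ q (hS q hqS) (by simpa [hqS] using hq), mul_zero]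
    · rw [h.2 σ ρ q hqS (by simpa [hqS] using Ne.symm hq), zero_mul]
  · simp

end SpinOp.ActsOn

/-! ### Several copies of a system, glued by permutations -/

/-- The configuration of the `k`-th sheet, when the copies of `q` are relabelled by `h q`. -/
def sheet {Q : Type*} {N : ℕ} (h : Q → Equiv.Perm (Fin N)) (k : Fin N)
    (σ : Q × Fin N → Fin 2) : Q → Fin 2 :=
  fun q => σ (q, h q k)

/-- The operator on `N` copies of a system that acts as `A k` on the `k`-th sheet. -/
def liftOp {Q : Type*} {N : ℕ} (h : Q → Equiv.Perm (Fin N)) (A : Fin N → SpinOp Q) :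
    SpinOp (Q × Fin N) :=
  fun σ τ => ∏ k, A k (sheet h k σ) (sheet h k τ)

section Lift

variable {Q : Type*} {N : ℕ}

/-- A configuration of `N` copies of a system is a family of `N` configurations. -/
def sheetEquiv (h : Q → Equiv.Perm (Fin N)) : (Q × Fin N → Fin 2) ≃ (Fin N → Q → Fin 2) where
  toFun σ k := sheet h k σ
  invFun ρ x := ρ ((h x.1).symm x.2) x.1
  left_inv σ := by funext x; simp [sheet]
  right_inv ρ := by funext k q; simp [sheet]

theorem sheetEquiv_apply (h : Q → Equiv.Perm (Fin N)) (σ : Q × Fin N → Fin 2) (k : Fin N) :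
    sheetEquiv h σ k = sheet h k σ := rfl

theorem sheet_add (h : Q → Equiv.Perm (Fin N)) (k : Fin N) (σ τ : Q × Fin N → Fin 2) :
    sheet h k (σ + τ) = sheet h k σ + sheet h k τ := rfl

theorem liftOp_conjTranspose (h : Q → Equiv.Perm (Fin N)) (A : Fin N → SpinOp Q) :
    (liftOp h A).conjTranspose = liftOp h fun k => (A k).conjTranspose := by
  ext σ τ
  simp [liftOp, Matrix.conjTranspose_apply]

theorem liftOp_actsOn (h : Q → Equiv.Perm (Fin N)) {A : Fin N → SpinOp Q} {S : Set Q}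
    (hA : ∀ k, (A k).ActsOn S) : (liftOp h A).ActsOn (Prod.fst ⁻¹' S) := by
  refine ⟨fun χ hχ σ τ => ?_, fun σ τ x hx hne => ?_⟩
  · refine Finset.prod_congr rfl fun k _ => ?_
    rw [sheet_add, sheet_add]
    exact (hA k).1 _ (fun q hq => hχ _ hq) _ _
  · refine Finset.prod_eq_zero (Finset.mem_univ ((h x.1).symm x.2)) ?_
    exact (hA _).2 _ _ x.1 hx (by simpa [sheet] using hne)

/-- A permutation `g` that does not depend on the spin only renames the sheets. For one operator
repeated on all sheets, the lifts by `h` and by `h'` therefore coincide. -/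
theorem liftOp_congr {s : Set Q} {A : Fin N → SpinOp Q} (hA : ∀ k, (A k).ActsOn s)
    {h h' : Q → Equiv.Perm (Fin N)} {g : Equiv.Perm (Fin N)} (hg : ∀ q ∈ s, h q = h' q * g) :
    liftOp h (fun k => A (g k)) = liftOp h' A := by
  classical
  ext σ τ
  by_cases hst : ∀ x : Q × Fin N, x.1 ∉ s → σ x = τ x
  · unfold liftOp
    rw [← Equiv.prod_comp g fun k => A k (sheet h' k σ) (sheet h' k τ)]
    refine Finset.prod_congr rfl fun k _ => ?_
    change A (g k) (sheet h k σ) (sheet h k τ) = A (g k) (sheet h' (g k) σ) (sheet h' (g k) τ)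
    rw [← (hA (g k)).1 (fun q => if q ∈ s then 0 else sheet h' (g k) σ q - sheet h k σ q)
      (fun q hq => if_pos hq)]
    congr 1 <;> funext q <;> by_cases hq : q ∈ s <;> simp [hq, sheet, hg]
    rw [hst (q, h q k) hq, hst (q, h' q (g k)) hq]
    abel
  · push Not at hst
    obtain ⟨x, hx, hne⟩ := hst
    rw [(liftOp_actsOn h fun k => hA (g k)).2 σ τ x hx hne,
      (liftOp_actsOn h' hA).2 σ τ x hx hne]

variable [Fintype Q]

theorem liftOp_one (h : Q → Equiv.Perm (Fin N)) : liftOp h (fun _ => (1 : SpinOp Q)) = 1 := by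
  ext σ τ
  by_cases hst : σ = τ
  · subst hst
    simp [liftOp]
  · rw [Matrix.one_apply_ne hst]
    obtain ⟨x, hx⟩ := Function.ne_iff.mp hst
    refine Finset.prod_eq_zero (Finset.mem_univ ((h x.1).symm x.2)) (Matrix.one_apply_ne ?_)
    exact Function.ne_iff.mpr ⟨x.1, by simpa [sheet] using hx⟩

variable [DecidableEq Q]

theorem liftOp_mul (h : Q → Equiv.Perm (Fin N)) (A B : Fin N → SpinOp Q) :
    liftOp h A * liftOp h B = liftOp h fun k => A k * B k := by
  ext σ τ
  simp only [liftOp, Matrix.mul_apply, ← Finset.prod_mul_distrib]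
  rw [Finset.prod_univ_sum, Fintype.piFinset_univ, ← (sheetEquiv h).sum_comp]
  rfl

/-- The expectation of the operator `O` in the state with amplitudes `ξ`. -/
def expect {Q : Type*} [Fintype Q] [DecidableEq Q] (ξ : (Q → Fin 2) → ℂ) (O : SpinOp Q) : ℂ :=
  ∑ σ, ∑ τ, star (ξ σ) * O σ τ * ξ τ

/-- All copies of a spin carry the same vector, so the product state on the copies splits as a
product over the sheets of any relabelling. -/
theorem expect_liftOp (h : Q → Equiv.Perm (Fin N)) (A : Fin N → SpinOp Q)
    (v : Q → Fin 2 → ℂ) :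
    expect (fun σ : Q × Fin N → Fin 2 => ∏ x, v x.1 (σ x)) (liftOp h A) =
      ∏ k, expect (fun σ : Q → Fin 2 => ∏ q, v q (σ q)) (A k) := by
  have key : ∀ σ : Q × Fin N → Fin 2,
      ∏ x, v x.1 (σ x) = ∏ k, ∏ q, v q (sheet h k σ q) := by
    intro σ
    rw [Finset.prod_comm, Fintype.prod_prod_type]
    exact Finset.prod_congr rfl fun q _ => (Equiv.prod_comp (h q) fun j => v q (σ (q, j))).symm
  simp only [expect, key]
  simp only [Finset.prod_univ_sum, Fintype.piFinset_univ]
  rw [← (sheetEquiv h).sum_comp]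
  refine Finset.sum_congr rfl fun σ _ => ?_
  rw [← (sheetEquiv h).sum_comp]
  refine Finset.sum_congr rfl fun τ _ => ?_
  simp only [sheetEquiv_apply, Finset.prod_mul_distrib, star_prod, liftOp]

theorem expect_mulVec (U O : SpinOp Q) (ξ : (Q → Fin 2) → ℂ) :
    expect (U.mulVec ξ) O = expect ξ (U.conjTranspose * O * U) := by
  have h : ∀ (O : SpinOp Q) (ξ : (Q → Fin 2) → ℂ),
      expect ξ O = dotProduct (star ξ) (O.mulVec ξ) := by
    intro O ξ
    simp only [expect, dotProduct, Matrix.mulVec, Finset.mul_sum, Pi.star_apply, mul_assoc]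
  rw [h, h, Matrix.star_mulVec, ← Matrix.dotProduct_mulVec, Matrix.mulVec_mulVec,
    Matrix.mulVec_mulVec, mul_assoc]

end Lift

/-! ### Light cones and lifts of circuits -/

section Neighbourhoods

variable {Q : Type*}

theorem edist_le_setDiam (Λ : SimpleGraph Q) {s : Finset Q} {x y : Q} (hx : x ∈ s) (hy : y ∈ s) :
    Λ.edist x y ≤ setDiam Λ s :=
  le_iSup₂_of_le (f := fun x (_ : x ∈ s) => ⨆ y ∈ s, Λ.edist x y) x hx <|
    le_iSup₂_of_le (f := fun y (_ : y ∈ s) => Λ.edist x y) y hy le_rfl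

/-- The spins at distance at most `r` from `S`. -/
def spinNhd (Λ : SimpleGraph Q) (r : ℕ∞) (S : Set Q) : Set Q :=
  {q | ∃ p ∈ S, Λ.edist p q ≤ r}

theorem subset_spinNhd (Λ : SimpleGraph Q) (r : ℕ∞) (S : Set Q) : S ⊆ spinNhd Λ r S :=
  fun q hq => ⟨q, hq, by simp⟩

theorem spinNhd_mono (Λ : SimpleGraph Q) {r r' : ℕ∞} (hr : r ≤ r') (S : Set Q) :
    spinNhd Λ r S ⊆ spinNhd Λ r' S :=
  fun _ ⟨p, hp, h⟩ => ⟨p, hp, h.trans hr⟩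

theorem spinNhd_spinNhd (Λ : SimpleGraph Q) (r r' : ℕ∞) (S : Set Q) :
    spinNhd Λ r (spinNhd Λ r' S) ⊆ spinNhd Λ (r + r') S := by
  rintro q ⟨p, ⟨p', hp', h'⟩, h⟩
  refine ⟨p', hp', (SimpleGraph.edist_triangle (v := p)).trans ?_⟩
  rw [add_comm r r']
  exact add_le_add h' h

end Neighbourhoods

section Circuits

variable {Q : Type*} [Fintype Q] [DecidableEq Q] {N : ℕ}

/-- The product of the lifts of the gates in a list; the copies of the spins in the support `s` of a
gate are relabelled by `hs s`. -/
noncomputable def liftGates (hs : Finset Q → Q → Equiv.Perm (Fin N)) (l : List (Gate Q)) :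
    SpinOp (Q × Fin N) :=
  (l.map fun a => liftOp (hs a.sites) fun _ => a.op).prod

/-- The lift of a circuit. -/
noncomputable def liftRounds (hs : Finset Q → Q → Equiv.Perm (Fin N)) (l : List (Round Q)) :
    SpinOp (Q × Fin N) :=
  (l.map fun r => liftGates hs r.gates).prod

theorem Gate.conjTranspose_mul_self (a : Gate Q) : a.op.conjTranspose * a.op = 1 :=
  (Matrix.mem_unitaryGroup_iff').mp a.unitary

theorem Gate.actsOn (a : Gate Q) : a.op.ActsOn (a.sites : Set Q) := a.supported.actsOn

/-- Heisenberg evolution through one round. A gate away from the support commutes with the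
observable and cancels against its adjoint. A gate that meets the support is, by `hc`, lifted by
`hs` just as it would be by `h`. -/
theorem liftGates_conj (hs : Finset Q → Q → Equiv.Perm (Fin N)) (h : Q → Equiv.Perm (Fin N))
    (l : List (Gate Q)) (hl : l.Pairwise fun a b => Disjoint a.sites b.sites) (S S' : Set Q)
    (hSS' : S ⊆ S') (A : Fin N → SpinOp Q) (hA : ∀ k, (A k).ActsOn S)
    (hsub : ∀ a ∈ l, (∃ q ∈ a.sites, q ∈ S) → (a.sites : Set Q) ⊆ S')
    (hc : ∀ a ∈ l, (∃ q ∈ a.sites, q ∈ S) → ∃ g, ∀ q ∈ a.sites, h q = hs a.sites q * g) :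
    (liftGates hs l).conjTranspose * liftOp h A * liftGates hs l =
        liftOp h (fun k => (l.map Gate.op).prod.conjTranspose * A k * (l.map Gate.op).prod) ∧
      ∀ k, SpinOp.ActsOn S'
        ((l.map Gate.op).prod.conjTranspose * A k * (l.map Gate.op).prod) := by
  induction l generalizing S A with
  | nil => simpa [liftGates] using fun k => (hA k).mono hSS'
  | cons a l ih =>
    rw [List.pairwise_cons] at hl
    have e1 : liftGates hs (a :: l) = liftOp (hs a.sites) (fun _ => a.op) * liftGates hs l := by
      simp [liftGates]
    have e2 : ((a :: l).map Gate.op).prod = a.op * (l.map Gate.op).prod := by simp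
    have key : ∃ S₁ ⊆ S', (∀ b ∈ l, (∃ q ∈ b.sites, q ∈ S₁) → ∃ q ∈ b.sites, q ∈ S) ∧
        (∀ k, SpinOp.ActsOn S₁ (a.op.conjTranspose * A k * a.op)) ∧
        (liftOp (hs a.sites) (fun _ => a.op)).conjTranspose * liftOp h A *
          liftOp (hs a.sites) (fun _ => a.op) =
            liftOp h fun k => a.op.conjTranspose * A k * a.op := by
      by_cases ha : ∃ q ∈ a.sites, q ∈ S
      -- The support grows, but by disjointness a later gate can meet it only inside the original
      -- `S`.
      · refine ⟨S ∪ a.sites, Set.union_subset hSS' (hsub a (by simp) ha), ?_, ?_, ?_⟩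
        · rintro b hb ⟨q, hq, hq' | hq'⟩
          · exact ⟨q, hq, hq'⟩
          · exact absurd hq (Finset.disjoint_left.mp (hl.1 b hb) hq')
        · intro k
          have ha' := a.actsOn.mono (Set.subset_union_right (s := S))
          exact (ha'.conjTranspose.mul ((hA k).mono Set.subset_union_left)).mul ha'
        · obtain ⟨g, hg⟩ := hc a (by simp) ha
          rw [← liftOp_congr (A := fun _ => a.op) (fun _ => a.actsOn) hg, liftOp_conjTranspose, liftOp_mul, liftOp_mul]
      · have hdis : Disjoint S (a.sites : Set Q) :=
          Set.disjoint_left.mpr fun q hq hq' => ha ⟨q, hq', hq⟩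
        have hA' : ∀ k, a.op.conjTranspose * A k * a.op = A k := fun k => by
          rw [mul_assoc, (hA k).commute a.actsOn hdis, ← mul_assoc, a.conjTranspose_mul_self,
            one_mul]
        refine ⟨S, hSS', fun b _ hb => hb, fun k => by rw [hA' k]; exact hA k, ?_⟩
        simp only [hA']
        rw [mul_assoc, (liftOp_actsOn h hA).commute (liftOp_actsOn _ fun _ => a.actsOn)
          (hdis.preimage _), ← mul_assoc, liftOp_conjTranspose, liftOp_mul]
        simp only [a.conjTranspose_mul_self]
        rw [liftOp_one, one_mul]
    obtain ⟨S₁, hS₁, hmeet, hact, hlift⟩ := key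
    obtain ⟨i1, i2⟩ := ih hl.2 S₁ hS₁ _ hact
      (fun b hb hb' => hsub b (by simp [hb]) (hmeet b hb hb'))
      (fun b hb hb' => hc b (by simp [hb]) (hmeet b hb hb'))
    have e3 : ∀ k, (a.op * (l.map Gate.op).prod).conjTranspose * A k *
        (a.op * (l.map Gate.op).prod) = (l.map Gate.op).prod.conjTranspose *
          (a.op.conjTranspose * A k * a.op) * (l.map Gate.op).prod := fun k => by
      rw [Matrix.conjTranspose_mul]
      simp only [mul_assoc]
    simp only [e1, e2, e3]
    refine ⟨?_, i2⟩
    rw [← i1, ← hlift, Matrix.conjTranspose_mul]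
    simp only [mul_assoc]

/-- Each round widens the support by at most `t`, so only gates in the light cone of radius
`l.length * t` matter; there `hc` compares `hs` with `h`. -/
theorem liftRounds_conj (Λ : SimpleGraph Q) (t : ℕ∞)
    (hs : Finset Q → Q → Equiv.Perm (Fin N)) (h : Q → Equiv.Perm (Fin N))
    (l : List (Round Q)) (ht : ∀ r ∈ l, ∀ a ∈ r.gates, setDiam Λ a.sites ≤ t)
    (S : Set Q) (A : Fin N → SpinOp Q) (hA : ∀ k, (A k).ActsOn S)
    (hc : ∀ s : Finset Q, (s : Set Q) ⊆ spinNhd Λ (l.length * t) S → setDiam Λ s ≤ t →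
      ∃ g, ∀ q ∈ s, h q = hs s q * g) :
    (liftRounds hs l).conjTranspose * liftOp h A * liftRounds hs l =
      liftOp h fun k => (l.map Round.op).prod.conjTranspose * A k * (l.map Round.op).prod := by
  induction l generalizing S A with
  | nil => simp [liftRounds]
  | cons r l ih =>
    have e1 : liftRounds hs (r :: l) = liftGates hs r.gates * liftRounds hs l := by
      simp [liftRounds]
    have e2 : ((r :: l).map Round.op).prod = r.op * (l.map Round.op).prod := by simp
    have hsub : ∀ a ∈ r.gates, (∃ q ∈ a.sites, q ∈ S) → (a.sites : Set Q) ⊆ spinNhd Λ t S := by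
      rintro a ha ⟨q, hq, hqS⟩ q' hq'
      exact ⟨q, hqS, (edist_le_setDiam Λ hq hq').trans (ht r (by simp) a ha)⟩
    have hlen : (((r :: l).length : ℕ) : ℕ∞) * t = l.length * t + t := by
      rw [List.length_cons, Nat.cast_succ, add_mul, one_mul]
    obtain ⟨h1, h2⟩ := liftGates_conj hs h r.gates r.disjoint S (spinNhd Λ t S)
      (subset_spinNhd Λ t S) A hA hsub fun a ha ha' =>
        hc a.sites ((hsub a ha ha').trans (spinNhd_mono Λ (by rw [hlen]; exact le_add_self) S))
          (ht r (by simp) a ha)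
    have h3 := ih (fun r' hr' => ht r' (by simp [hr'])) (spinNhd Λ t S) _ h2 fun s hs' hd =>
      hc s (hs'.trans (by rw [hlen]; exact spinNhd_spinNhd Λ _ _ S)) hd
    have e3 : ∀ k, (r.op * (l.map Round.op).prod).conjTranspose * A k *
        (r.op * (l.map Round.op).prod) = (l.map Round.op).prod.conjTranspose *
          (r.op.conjTranspose * A k * r.op) * (l.map Round.op).prod := fun k => by
      rw [Matrix.conjTranspose_mul]
      simp only [mul_assoc]
    simp only [e1, e2, e3]
    change _ = liftOp h fun k => (l.map Round.op).prod.conjTranspose *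
      ((r.gates.map Gate.op).prod.conjTranspose * A k * (r.gates.map Gate.op).prod) *
        (l.map Round.op).prod
    rw [← h3, ← h1, Matrix.conjTranspose_mul]
    simp only [mul_assoc]

/-- A state made from a product state by a circuit of range at most `R` has a lift to `N` copies
of the system for every rule `hs` by which the copies are relabelled; an observable sees `N`
independent copies of the state as long as the relabelling is trivial around its support. -/
theorem IsTrivialState.exists_lift {Λ : SimpleGraph Q} {R : ℕ} {ψ : SpinSpace Q}
    (hψ : IsTrivialState Λ R ψ) (hs : Finset Q → Q → Equiv.Perm (Fin N)) :
    ∃ Ψ : (Q × Fin N → Fin 2) → ℂ, ∀ (h : Q → Equiv.Perm (Fin N)) (S : Set Q)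
      (A : Fin N → SpinOp Q), (∀ k, (A k).ActsOn S) →
      (∀ s : Finset Q, (s : Set Q) ⊆ spinNhd Λ R S → setDiam Λ s ≤ R →
        ∃ g, ∀ q ∈ s, h q = hs s q * g) →
      expect Ψ (liftOp h A) = ∏ k, expect ψ.ofLp (A k) := by
  obtain ⟨-, c, ξ, hrange, ⟨v, -, hv⟩, hdist⟩ := hψ
  have hψ' : ψ.ofLp = c.op.mulVec ξ.ofLp := by
    have := norm_le_zero_iff.mp hdist
    rw [sub_eq_zero.mp this]
    simp [SpinOp.app, Matrix.toEuclideanLin]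
  have hξ : ξ.ofLp = fun σ => ∏ q, v q (σ q) := funext hv
  refine ⟨(liftRounds hs c.rounds).mulVec fun σ => ∏ x, v x.1 (σ x), fun h S A hA hc => ?_⟩
  have ht : ∀ r ∈ c.rounds, ∀ a ∈ r.gates, setDiam Λ a.sites ≤ c.gateRange Λ :=
    fun r hr a ha => le_iSup₂_of_le (f := fun L (_ : L ∈ c.rounds) => ⨆ a ∈ L.gates,
      setDiam Λ a.sites) r hr <|
        le_iSup₂_of_le (f := fun a (_ : a ∈ r.gates) => setDiam Λ a.sites) a ha le_rfl
  rw [expect_mulVec]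
  have key : (liftRounds hs c.rounds).conjTranspose * liftOp h A * liftRounds hs c.rounds =
      liftOp h fun k => c.op.conjTranspose * A k * c.op := by
    -- The range is depth times gate range, so it bounds the gate range only if there is a round.
    rcases Nat.eq_zero_or_pos c.rounds.length with h0 | h0
    · have h0' := List.length_eq_zero_iff.mp h0
      simp [liftRounds, Circuit.op, h0']
    · have hle : c.gateRange Λ ≤ R := by
        refine le_trans ?_ hrange
        rw [Circuit.range]
        calc c.gateRange Λ = 1 * c.gateRange Λ := (one_mul _).symm
          _ ≤ _ := mul_le_mul_left (by exact_mod_cast h0) _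
      exact liftRounds_conj Λ (c.gateRange Λ) hs h c.rounds ht S A hA fun s hs' hd =>
        hc s (hs'.trans (spinNhd_mono Λ hrange S)) (hd.trans hle)
  rw [key, expect_liftOp h _ fun q => (v q).ofLp]
  refine Finset.prod_congr rfl fun k _ => ?_
  rw [hψ', expect_mulVec, hξ]

end Circuits

/-! ### Parallel transport along short walks -/

section Transport

open SimpleGraph

variable {V Γ : Type*} [Group Γ] {G : SimpleGraph V}

/-- The transport along a walk, for a connection that assigns `κ u v` to the step from `u`
to `v`. -/
def transport (κ : V → V → Γ) : {u v : V} → G.Walk u v → Γ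
  | _, _, .nil => 1
  | u, _, .cons (v := w) _ p => transport κ p * κ u w

theorem transport_append (κ : V → V → Γ) {u v w : V} (p : G.Walk u v) (q : G.Walk v w) :
    transport κ (p.append q) = transport κ q * transport κ p := by
  induction p with
  | nil => simp [transport]
  | cons h p ih => simp [transport, ih, mul_assoc]

variable {κ : V → V → Γ}

theorem transport_reverse (hκ : ∀ u v, G.Adj u v → κ v u * κ u v = 1) {u v : V}
    (p : G.Walk u v) : transport κ p.reverse = (transport κ p)⁻¹ := by
  induction p with
  | nil => simp [transport]
  | cons h p ih =>
    rw [Walk.reverse_cons, transport_append, ih]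
    simp only [transport, one_mul, mul_inv_rev]
    rw [eq_inv_of_mul_eq_one_left (hκ _ _ h)]

/-- A path closed up by an edge is either that edge traversed back and forth, or a cycle, which its
length excludes. -/
theorem transport_cons_path (hκ : ∀ u v, G.Adj u v → κ v u * κ u v = 1) {u v : V}
    (h : G.Adj u v) (q : G.Walk v u) (hq : q.IsPath) (hlen : ((q.length + 1 : ℕ) : ℕ∞) < G.egirth) :
    transport κ q * κ u v = 1 := by
  by_cases he : s(u, v) ∈ q.edges
  · cases q with
    | nil => exact absurd h (G.loopless.irrefl _)
    | @cons _ w _ h' q' =>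
      rw [Walk.cons_isPath_iff] at hq
      rw [Walk.edges_cons, List.mem_cons] at he
      rcases he with he | he
      · have hw : u = w := by
          rcases Sym2.eq_iff.mp he with ⟨h1, h2⟩ | ⟨h1, h2⟩
          · exact absurd (h1.symm ▸ h) (by rw [h1]; exact G.loopless.irrefl _)
          · exact h1
        subst hw
        rw [(Walk.isPath_iff_nil.mp hq.1).eq_nil]
        simpa [transport] using hκ _ _ h
      · exact absurd (q'.snd_mem_support_of_mem_edges he) hq.2
  · have hc := le_egirth.mp le_rfl u (.cons h q) ((Walk.cons_isCycle_iff q h).mpr ⟨hq, he⟩)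
    exact absurd hlen (not_lt.mpr (by simpa using hc))

-- Bypassing deletes closed pieces, each an edge followed by a path and no longer than the walk, and
-- their transport is trivial.
open Classical in
theorem transport_bypass (hκ : ∀ u v, G.Adj u v → κ v u * κ u v = 1) {u v : V}
    (p : G.Walk u v) (hlen : (p.length : ℕ∞) < G.egirth) :
    transport κ p.bypass = transport κ p := by
  induction p with
  | nil => rfl
  | @cons u w v h p ih =>
    have hlen' : (p.length : ℕ∞) < G.egirth :=
      lt_of_le_of_lt (by exact_mod_cast Nat.le_succ _) hlen
    have ih' := ih hlen'
    rw [Walk.bypass]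
    split_ifs with hu
    · have hsplit := congrArg (transport κ) (p.bypass.take_spec hu)
      rw [transport_append, ih'] at hsplit
      have hb : (p.bypass.takeUntil u hu).length ≤ p.length :=
        (p.bypass.length_takeUntil_le_length hu).trans p.length_bypass_le_length
      have h1 := transport_cons_path hκ h (p.bypass.takeUntil u hu)
        (p.bypass_isPath.takeUntil hu)
        (lt_of_le_of_lt (by
          rw [Walk.length_cons]
          exact_mod_cast Nat.succ_le_succ hb) hlen)
      simp only [transport]
      rw [← hsplit, mul_assoc, h1, mul_one]
    · simp only [transport, ih']

/-- A closed path has no edges; hence every connection is flat at scales below the girth. -/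
theorem transport_eq_one (hκ : ∀ u v, G.Adj u v → κ v u * κ u v = 1) {u : V}
    (p : G.Walk u u) (hlen : (p.length : ℕ∞) < G.egirth) : transport κ p = 1 := by
  classical
  rw [← transport_bypass hκ p hlen, (Walk.isPath_iff_nil.mp p.bypass_isPath).eq_nil]
  rfl

open Classical in
/-- The transport along a shortest walk. -/
noncomputable def geoTransport (G : SimpleGraph V) (κ : V → V → Γ) (u v : V) : Γ :=
  if h : ∃ p : G.Walk u v, p.length = G.dist u v then transport κ h.choose else 1

theorem exists_geoTransport_eq (hG : G.Connected) (κ : V → V → Γ) (u v : V) :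
    ∃ p : G.Walk u v, p.length = G.dist u v ∧ geoTransport G κ u v = transport κ p := by
  have h := hG.exists_walk_length_eq_dist u v
  exact ⟨h.choose, h.choose_spec, dif_pos h⟩

/-- The geodesic triangle is a closed walk shorter than the girth. -/
theorem geoTransport_mul (hG : G.Connected) (hκ : ∀ u v, G.Adj u v → κ v u * κ u v = 1)
    {u v w : V}
    (hlen : ((G.dist u v + G.dist v w + G.dist u w : ℕ) : ℕ∞) < G.egirth) :
    geoTransport G κ v w * geoTransport G κ u v = geoTransport G κ u w := by
  obtain ⟨p, hp, hp'⟩ := exists_geoTransport_eq hG κ u v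
  obtain ⟨q, hq, hq'⟩ := exists_geoTransport_eq hG κ v w
  obtain ⟨r, hr, hr'⟩ := exists_geoTransport_eq hG κ u w
  have := transport_eq_one hκ ((p.append q).append r.reverse)
    (by simpa [hp, hq, hr] using hlen)
  rw [transport_append, transport_append, transport_reverse hκ] at this
  rw [hp', hq', hr']
  exact (inv_mul_eq_one.mp this).symm

theorem geoTransport_adj (hG : G.Connected) (hκ : ∀ u v, G.Adj u v → κ v u * κ u v = 1)
    {u v : V} (h : G.Adj u v) (hg : 2 < G.egirth) : geoTransport G κ u v = κ u v := by
  obtain ⟨p, hp, hp'⟩ := exists_geoTransport_eq hG κ u v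
  have hd : G.dist u v = 1 := SimpleGraph.dist_eq_one_iff_adj.mpr h
  have := transport_eq_one hκ (p.append (.cons h.symm .nil)) (by simpa [hp, hd] using hg)
  rw [transport_append, ← hp'] at this
  simp only [transport, one_mul] at this
  have h2 := hκ _ _ h
  exact mul_left_cancel (this.trans h2.symm)

theorem geoTransport_self (hG : G.Connected) (κ : V → V → Γ) (u : V) :
    geoTransport G κ u u = 1 := by
  obtain ⟨p, hp, hp'⟩ := exists_geoTransport_eq hG κ u u
  rw [SimpleGraph.dist_self] at hp
  rw [hp', (Walk.length_eq_zero_iff.mp hp).eq_nil]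
  rfl

end Transport

/-! ### The metric on the `1`-cells -/

section Cells

open SimpleGraph

variable {V : Type*} {G : SimpleGraph V}

/-- A vertex of `G` within distance one of the first coordinates of a `1`-cell. -/
noncomputable def OneCell.fstVertex : OneCell G → V
  | .inl (e, _) => (Quot.out (e : Sym2 V)).1
  | .inr (i, _) => i

/-- A vertex of `G` within distance one of the second coordinates of a `1`-cell. -/
noncomputable def OneCell.sndVertex : OneCell G → V
  | .inl (_, i) => i
  | .inr (_, e) => (Quot.out (e : Sym2 V)).1

theorem edge_eq_out (e : G.edgeSet) :
    (e : Sym2 V) = s((Quot.out (e : Sym2 V)).1, (Quot.out (e : Sym2 V)).2) :=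
  (Quot.out_eq (e : Sym2 V)).symm

theorem adj_out (e : G.edgeSet) :
    G.Adj (Quot.out (e : Sym2 V)).1 (Quot.out (e : Sym2 V)).2 := by
  have := e.2
  rw [edge_eq_out e, mem_edgeSet] at this
  exact this

theorem dist_out_le_one (e : G.edgeSet) {x : V} (hx : x ∈ (e : Sym2 V)) :
    G.dist (Quot.out (e : Sym2 V)).1 x ≤ 1 := by
  rw [edge_eq_out e, Sym2.mem_iff] at hx
  rcases hx with h | h
  · rw [h, SimpleGraph.dist_self]
    exact zero_le_one
  · rw [h, SimpleGraph.dist_eq_one_iff_adj.mpr (adj_out e)]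

variable [Fintype V] [DecidableEq V]

theorem OneCell.dist_fstVertex_le {c : OneCell G} {s : ZeroCell G} (h : s ∈ OneCell.ends G c) :
    G.dist (OneCell.fstVertex c) s.1 ≤ 1 := by
  rcases c with ⟨e, i⟩ | ⟨i, e⟩ <;> simp only [OneCell.ends, Finset.mem_filter] at h
  · exact dist_out_le_one e h.2.1
  · simp [OneCell.fstVertex, h.2.1]

theorem OneCell.dist_sndVertex_le {c : OneCell G} {s : ZeroCell G} (h : s ∈ OneCell.ends G c) :
    G.dist (OneCell.sndVertex c) s.2 ≤ 1 := by
  rcases c with ⟨e, i⟩ | ⟨i, e⟩ <;> simp only [OneCell.ends, Finset.mem_filter] at h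
  · simp [OneCell.sndVertex, h.2.2]
  · exact dist_out_le_one e h.2.2

/-- Neighbouring 1-cells share a 0-cell, and the vertex attached to each is within distance one of
it; hence the factor two. This is applied to both coordinates. -/
theorem dist_le_of_edist_cellGraph_le (hG : G.Connected) (g : OneCell G → V)
    (g' : ZeroCell G → V) (hg : ∀ c s, s ∈ OneCell.ends G c → G.dist (g c) (g' s) ≤ 1)
    {c c' : OneCell G} {r : ℕ} (h : (cellGraph G).edist c c' ≤ r) :
    G.dist (g c) (g c') ≤ 2 * r := by
  have hne : (cellGraph G).edist c c' ≠ ⊤ := ne_top_of_le_ne_top (by simp) h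
  obtain ⟨p, hp⟩ := exists_walk_of_edist_ne_top hne
  rw [← hp, Nat.cast_le] at h
  refine le_trans ?_ (Nat.mul_le_mul_left 2 h)
  clear h hne hp
  induction p with
  | nil => simp
  | @cons c₁ c₂ c₃ hadj p ih =>
    obtain ⟨s, hs, hs'⟩ := hadj.2
    have h1 := hG.dist_triangle (u := g c₁) (v := g' s) (w := g c₂)
    have h2 := hG.dist_triangle (u := g c₁) (v := g c₂) (w := g c₃)
    have h3 := hg _ _ hs
    have h4 := hg _ _ hs'
    rw [SimpleGraph.dist_comm] at h4
    rw [Walk.length_cons]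
    omega

end Cells

/-! ### Pauli operators in the configuration basis -/

/-- The eigenvalue of `S^z` as a function of the spin. -/
def spinSign : Fin 2 → ℝ := ![1, -1]

theorem spinSign_add (a b : Fin 2) : spinSign (a + b) = spinSign a * spinSign b := by
  fin_cases a <;> fin_cases b <;> simp [spinSign]

theorem spinSign_sum {Q : Type*} [DecidableEq Q] (S : Finset Q) (σ : Q → Fin 2) :
    spinSign (∑ q ∈ S, σ q) = ∏ q ∈ S, spinSign (σ q) := by
  induction S using Finset.induction_on with
  | empty => simp [spinSign]
  | insert a S ha ih => rw [Finset.sum_insert ha, Finset.prod_insert ha, spinSign_add, ih]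

/-- The operator that shifts configurations by `χ`. -/
def shiftOp {Q : Type*} [Fintype Q] (χ : Q → Fin 2) : SpinOp Q :=
  fun σ τ => if τ = σ + χ then 1 else 0

theorem shiftOp_actsOn {Q : Type*} [Fintype Q] {S : Set Q} {χ : Q → Fin 2} (hχ : ∀ q, q ∉ S → χ q = 0) :
    SpinOp.ActsOn S (shiftOp χ) := by
  refine ⟨fun χ' _ σ τ => ?_, fun σ τ q hq hne => ?_⟩
  · simp only [shiftOp, add_right_comm σ χ' χ, add_left_inj]
  · refine if_neg fun h => hne ?_
    rw [h, Pi.add_apply, hχ q hq, add_zero]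

section Pauli

variable {Q : Type*} [Fintype Q] [DecidableEq Q]

theorem noncommProd_siteOp (m : Matrix (Fin 2) (Fin 2) ℂ) (S : Finset Q) :
    (S.noncommProd (fun q => siteOp q m) fun q _ r _ _ => siteOp_commute m q r) =
      tensorOp fun q => if q ∈ S then m else 1 := by
  induction S using Finset.induction_on with
  | empty => exact (Finset.noncommProd_empty _ _).trans tensorOp_one.symm
  | insert a S ha ih =>
    refine (Finset.noncommProd_insert_of_notMem _ _ _ _ ha).trans ?_
    rw [ih, siteOp, ← tensorOp_mul]
    congr 1
    funext q
    by_cases hq : q = a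
    · subst hq
      simp [ha]
    · simp [hq]

/-- The indicator function of a set of spins, with values in `ℤ/2`. -/
def spinIndicator {Q : Type*} [DecidableEq Q] (S : Finset Q) : Q → Fin 2 :=
  fun q => if q ∈ S then 1 else 0

theorem prodX_eq (S : Finset Q) : prodX S = shiftOp (spinIndicator S) := by
  have hX : ∀ a b : Fin 2, (!![0, 1; 1, 0] : Matrix (Fin 2) (Fin 2) ℂ) a b =
      if b = a + 1 then 1 else 0 := by
    intro a b
    fin_cases a <;> fin_cases b <;> simp
  have h := noncommProd_siteOp !![0, 1; 1, 0] S
  refine Eq.trans h ?_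
  ext σ τ
  simp only [tensorOp, shiftOp]
  have hq : ∀ q, (if q ∈ S then (!![0, 1; 1, 0] : Matrix (Fin 2) (Fin 2) ℂ) else 1) (σ q) (τ q) =
      if τ q = (σ + spinIndicator S) q then 1 else 0 := by
    intro q
    by_cases h : q ∈ S
    · simp [h, hX, spinIndicator]
    · simp [h, spinIndicator, Matrix.one_apply, eq_comm]
  simp only [hq, funext_iff]
  by_cases h : ∀ q, τ q = (σ + spinIndicator S) q
  · simp [h]
  · rw [if_neg h]
    push Not at h
    obtain ⟨q, hne⟩ := h
    exact Finset.prod_eq_zero (Finset.mem_univ q) (if_neg hne)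

theorem prodZ_eq (S : Finset Q) :
    prodZ S = Matrix.diagonal fun σ => ((spinSign (∑ q ∈ S, σ q) : ℝ) : ℂ) := by
  have hZ : ∀ a b : Fin 2, (!![1, 0; 0, -1] : Matrix (Fin 2) (Fin 2) ℂ) a b =
      if a = b then ((spinSign a : ℝ) : ℂ) else 0 := by
    intro a b
    fin_cases a <;> fin_cases b <;> simp [spinSign]
  have h := noncommProd_siteOp !![1, 0; 0, -1] S
  refine Eq.trans h ?_
  ext σ τ
  by_cases hst : σ = τ
  · subst hst
    rw [Matrix.diagonal_apply_eq, spinSign_sum, Complex.ofReal_prod, tensorOp,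
      ← Finset.prod_filter_mul_prod_filter_not Finset.univ (· ∈ S)]
    rw [Finset.prod_eq_one (s := Finset.univ.filter fun q => q ∉ S), mul_one]
    · rw [Finset.filter_mem_eq_inter, Finset.univ_inter]
      exact Finset.prod_congr rfl fun q hq => by rw [if_pos hq, hZ, if_pos rfl]
    · intro q hq
      rw [if_neg (by simpa using hq), Matrix.one_apply_eq]
  · rw [Matrix.diagonal_apply_ne _ hst]
    obtain ⟨q, hq⟩ := Function.ne_iff.mp hst
    refine Finset.prod_eq_zero (Finset.mem_univ q) ?_
    by_cases h : q ∈ S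
    · simp only [h, if_true, hZ, if_neg hq]
    · simp only [h, if_false, Matrix.one_apply_ne hq]

theorem shiftOp_mul (χ χ' : Q → Fin 2) : shiftOp χ * shiftOp χ' = shiftOp (χ + χ') := by
  ext σ τ
  rw [Matrix.mul_apply, Finset.sum_eq_single (σ + χ)]
  · simp [shiftOp, add_assoc]
  · intro ρ _ hρ
    simp [shiftOp, hρ]
  · simp

theorem shiftOp_app (χ : Q → Fin 2) (ψ : SpinSpace Q) (σ : Q → Fin 2) :
    (shiftOp χ).app ψ σ = ψ (σ + χ) := by
  simp [SpinOp.app, Matrix.toEuclideanLin, Matrix.mulVec, dotProduct, shiftOp]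

theorem expect_shiftOp (χ : Q → Fin 2) (ξ : (Q → Fin 2) → ℂ) :
    expect ξ (shiftOp χ) = ∑ σ, star (ξ σ) * ξ (σ + χ) := by
  simp [expect, shiftOp]

theorem expect_one (ψ : SpinSpace Q) : expect ψ.ofLp 1 = ((‖ψ‖ ^ 2 : ℝ) : ℂ) := by
  rw [EuclideanSpace.norm_sq_eq, Complex.ofReal_sum]
  simp [expect, Matrix.one_apply, Complex.conj_mul']

theorem inner_app (ψ : SpinSpace Q) (T : SpinOp Q) :
    inner ℂ ψ (T.app ψ) = expect ψ.ofLp T := by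
  simp only [PiLp.inner_apply, SpinOp.app, expect, Matrix.toEuclideanLin]
  refine Finset.sum_congr rfl fun σ _ => ?_
  simp only [Matrix.toLpLin_apply, Matrix.mulVec, dotProduct, RCLike.inner_apply, Finset.sum_mul,
    RCLike.star_def]
  exact Finset.sum_congr rfl fun τ _ => by ring

theorem sum_norm_sq_add (χ : Q → Fin 2) (ψ : SpinSpace Q) :
    ∑ σ, ‖ψ (σ + χ)‖ ^ 2 = ‖ψ‖ ^ 2 := by
  rw [EuclideanSpace.norm_sq_eq]
  exact Equiv.sum_comp (Equiv.addRight χ) fun σ => ‖ψ σ‖ ^ 2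

/-- The expectation is at most the overlap of the moduli of `ψ` and its shift. If it has modulus one
for a unit vector, the moduli are therefore invariant. -/
theorem sum_sq_norm_sub (χ : Q → Fin 2) (ψ : SpinSpace Q) :
    ∑ σ, (‖ψ σ‖ - ‖ψ (σ + χ)‖) ^ 2 ≤ 2 * (‖ψ‖ ^ 2 - ‖expect ψ.ofLp (shiftOp χ)‖) := by
  have h : ‖expect ψ.ofLp (shiftOp χ)‖ ≤ ∑ σ, ‖ψ σ‖ * ‖ψ (σ + χ)‖ := by
    rw [expect_shiftOp]
    exact (norm_sum_le _ _).trans_eq (Finset.sum_congr rfl fun σ _ => by simp)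
  have h2 : ∑ σ, (‖ψ σ‖ - ‖ψ (σ + χ)‖) ^ 2 =
      ∑ σ, ‖ψ σ‖ ^ 2 + ∑ σ, ‖ψ (σ + χ)‖ ^ 2 - 2 * ∑ σ, ‖ψ σ‖ * ‖ψ (σ + χ)‖ := by
    rw [Finset.mul_sum, ← Finset.sum_add_distrib, ← Finset.sum_sub_distrib]
    exact Finset.sum_congr rfl fun σ _ => by ring
  rw [h2, sum_norm_sq_add, ← EuclideanSpace.norm_sq_eq]
  linarith

theorem norm_add_eq_of_one_le {χ : Q → Fin 2} {ψ : SpinSpace Q} (hψ : ‖ψ‖ = 1)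
    (h : 1 ≤ ‖expect ψ.ofLp (shiftOp χ)‖) (σ : Q → Fin 2) : ‖ψ (σ + χ)‖ = ‖ψ σ‖ := by
  have h1 := sum_sq_norm_sub χ ψ
  have h2 := Finset.single_le_sum (f := fun σ => (‖ψ σ‖ - ‖ψ (σ + χ)‖) ^ 2)
    (fun σ _ => sq_nonneg _) (Finset.mem_univ σ)
  have h3 : (‖ψ σ‖ - ‖ψ (σ + χ)‖) ^ 2 ≤ 0 := by
    rw [hψ] at h1
    simp only at h2
    linarith
  have h4 := pow_eq_zero_iff (two_ne_zero) |>.mp (le_antisymm h3 (sq_nonneg _))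
  linarith

theorem norm_expect_shiftOp_le (χ : Q → Fin 2) {ψ : SpinSpace Q} (hψ : ‖ψ‖ = 1) :
    ‖expect ψ.ofLp (shiftOp χ)‖ ≤ 1 := by
  have h1 := sum_sq_norm_sub χ ψ
  have h2 : 0 ≤ ∑ σ, (‖ψ σ‖ - ‖ψ (σ + χ)‖) ^ 2 := Finset.sum_nonneg fun _ _ => sq_nonneg _
  rw [hψ] at h1
  linarith

/-- In a trivial state, distant observables are uncorrelated. -/
theorem IsTrivialState.expect_mul {Λ : SimpleGraph Q} {R : ℕ} {ψ : SpinSpace Q}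
    (hψ : IsTrivialState Λ R ψ) {S₁ S₂ : Set Q} {A₁ A₂ : SpinOp Q} (h₁ : A₁.ActsOn S₁)
    (h₂ : A₂.ActsOn S₂) (hfar : ∀ p ∈ S₁, ∀ q ∈ S₂, ¬ Λ.edist p q ≤ (3 * R : ℕ)) :
    expect ψ.ofLp (A₁ * A₂) = expect ψ.ofLp A₁ * expect ψ.ofLp A₂ := by
  classical
  obtain ⟨Ψ, hΨ⟩ := hψ.exists_lift (N := 2) fun _ _ => 1
  -- Swapping the two copies away from `S₁` puts `A₁` on one copy and `A₂` on the other onto a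
  -- single sheet. With the wall at distance `2 * R` from `S₁`, a gate of diameter at most `R` near
  -- `S₁` stays inside it, and the separation `3 * R` keeps those near `S₂` outside.
  set h : Q → Equiv.Perm (Fin 2) := fun q =>
    if q ∈ spinNhd Λ (2 * R : ℕ) S₁ then 1 else Equiv.swap 0 1 with hh
  have hone : expect ψ.ofLp 1 = 1 := by rw [expect_one, hψ.1]; simp
  have a₁ := h₁.mono (Set.subset_union_left (t := S₂))
  have a₂ := h₂.mono (Set.subset_union_right (s := S₁))
  have e1 := hΨ (fun _ => 1) (S₁ ∪ S₂) ![A₁, A₂] (by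
    intro k; fin_cases k <;> simpa) fun s _ _ => ⟨1, by simp⟩
  have e2 := hΨ h (S₁ ∪ S₂) ![A₁ * A₂, 1] (by
    intro k
    fin_cases k
    · exact a₁.mul a₂
    · exact SpinOp.ActsOn.one) (by
    intro s hs hd
    by_cases hmeet : ∃ q ∈ s, q ∈ spinNhd Λ R S₁
    · obtain ⟨q, hq, p, hp, hpq⟩ := hmeet
      refine ⟨1, fun q' hq' => ?_⟩
      simp only [hh, mul_one]
      refine if_pos ⟨p, hp, (SimpleGraph.edist_triangle (v := q)).trans ?_⟩
      have := add_le_add hpq ((edist_le_setDiam Λ hq hq').trans hd)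
      refine this.trans_eq ?_
      push_cast
      ring
    · refine ⟨Equiv.swap 0 1, fun q hq => ?_⟩
      simp only [hh, one_mul]
      refine if_neg ?_
      rintro ⟨p, hp, hpq⟩
      obtain ⟨p', hp', hpq'⟩ := hs hq
      rcases hp' with hp' | hp'
      · exact hmeet ⟨q, hq, p', hp', hpq'⟩
      · refine hfar p hp p' hp' ((SimpleGraph.edist_triangle (v := q)).trans ?_)
        rw [SimpleGraph.edist_comm (u := q)]
        refine (add_le_add hpq hpq').trans_eq ?_
        push_cast
        ring)
  have e3 : liftOp h ![A₁ * A₂, 1] = liftOp (fun _ => 1) ![A₁, A₂] := by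
    have f1 : liftOp h (fun k => ![A₁, 1] ((1 : Equiv.Perm (Fin 2)) k)) =
        liftOp (fun _ => 1) ![A₁, 1] := by
      refine liftOp_congr (s := S₁) (fun k => ?_) fun q hq => ?_
      · fin_cases k
        · exact h₁
        · exact SpinOp.ActsOn.one
      · simp only [hh, mul_one]
        exact if_pos (subset_spinNhd Λ _ _ hq)
    have f2 : liftOp h (fun k => ![1, A₂] ((Equiv.swap 0 1 : Equiv.Perm (Fin 2)) k)) =
        liftOp (fun _ => 1) ![1, A₂] := by
      refine liftOp_congr (s := S₂) (fun k => ?_) fun q hq => ?_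
      · fin_cases k
        · exact SpinOp.ActsOn.one
        · exact h₂
      · simp only [hh, one_mul]
        refine if_neg ?_
        rintro ⟨p, hp, hpq⟩
        exact hfar p hp q hq (hpq.trans (by exact_mod_cast by omega))
    have g1 := liftOp_mul h ![A₁, 1] ![A₂, 1]
    have g2 := liftOp_mul (fun _ : Q => (1 : Equiv.Perm (Fin 2))) ![A₁, 1] ![1, A₂]
    have c1 : (fun k => ![A₁, 1] k * ![A₂, 1] k) = ![A₁ * A₂, 1] := by
      funext k; fin_cases k <;> simp
    have c2 : (fun k => ![A₁, 1] k * ![1, A₂] k) = ![A₁, A₂] := by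
      funext k; fin_cases k <;> simp
    have c3 : (fun k => ![1, A₂] ((Equiv.swap 0 1 : Equiv.Perm (Fin 2)) k)) = ![A₂, 1] := by
      funext k; fin_cases k <;> simp
    rw [c1] at g1
    rw [c2] at g2
    rw [c3] at f2
    simp only [Equiv.Perm.coe_one, id] at f1
    rw [← g1, ← g2, ← f2, ← f1]
  rw [e3, e1] at e2
  simp only [Fin.prod_univ_two, Matrix.cons_val_zero, Matrix.cons_val_one, hone, mul_one] at e2
  exact e2.symm

end Pauli

/-! ### Invariance under the cocycles `e × V` -/

theorem add_self_fin_two (a : Fin 2) : a + a = 0 := by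
  fin_cases a <;> rfl

section RowShift

open SimpleGraph

variable {V : Type*} {G : SimpleGraph V}

/-- The `1`-cochain that takes the value `y e` on `e × {i}` for all `i`, and vanishes on the
`1`-cells vertex × edge. -/
def rowShift (y : G.edgeSet → Fin 2) : OneCell G → Fin 2
  | .inl (e, _) => y e
  | .inr _ => 0

theorem rowShift_add (y y' : G.edgeSet → Fin 2) :
    rowShift (y + y') = rowShift y + rowShift y' := by
  funext c
  rcases c with c | c <;> simp [rowShift]

theorem rowShift_zero : rowShift (0 : G.edgeSet → Fin 2) = 0 := by
  funext c
  rcases c with c | c <;> simp [rowShift]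

variable [Fintype V] [DecidableEq V]

/-- The coboundary of a `0`-cochain of `G` with values in `ℤ/2`. -/
def edgeCoboundary (G : SimpleGraph V) : (V → Fin 2) →+ (G.edgeSet → Fin 2) where
  toFun τ e := ∑ i ∈ Finset.univ.filter fun i => i ∈ (e : Sym2 V), τ i
  map_zero' := by funext e; simp
  map_add' τ τ' := by funext e; simp [Finset.sum_add_distrib]

theorem edgeCoboundary_apply (τ : V → Fin 2) (e : G.edgeSet) {x y : V}
    (hxy : (e : Sym2 V) = s(x, y)) : edgeCoboundary G τ e = τ x + τ y := by
  have hne : x ≠ y := by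
    have := e.2
    rw [hxy, mem_edgeSet] at this
    exact this.ne
  have : (Finset.univ.filter fun i => i ∈ (e : Sym2 V)) = {x, y} := by
    ext i
    simp [hxy]
  simp only [edgeCoboundary, AddMonoidHom.coe_mk, ZeroHom.coe_mk, this]
  exact Finset.sum_pair hne

/-- A set of vertices, near the endpoint `a` of the edge `e = {a, b}` on the far side from `b`,
whose edge boundary consists of `e` and of edges far from `e`. -/
theorem exists_branch (hG : G.Connected) (e : G.edgeSet) (L : ℕ)
    (hg : ((2 * L + 3 : ℕ) : ℕ∞) ≤ G.egirth) :
    ∃ α : V → Fin 2, edgeCoboundary G α e = 1 ∧ ∀ e' : G.edgeSet, e' ≠ e →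
      edgeCoboundary G α e' ≠ 0 → L ≤ G.dist (Quot.out (e : Sym2 V)).1 (Quot.out (e' : Sym2 V)).1 := by
  classical
  -- The transport counts crossings of `e` modulo two. The branch consists of the vertices within
  -- distance `L` of `a` whose geodesic from `a` crosses `e` an even number of times.
  set κ : V → V → Multiplicative (ZMod 2) := fun u v =>
    if s(u, v) = (e : Sym2 V) then Multiplicative.ofAdd 1 else 1 with hκdef
  have hκ : ∀ u v, G.Adj u v → κ v u * κ u v = 1 := by
    intro u v _
    simp only [hκdef, Sym2.eq_swap (a := v) (b := u)]
    split_ifs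
    · rfl
    · rfl
  have hlt : ∀ m : ℕ, m ≤ 2 * L + 2 → (m : ℕ∞) < G.egirth := fun m hm =>
    lt_of_lt_of_le (by exact_mod_cast Nat.lt_succ_of_le hm) hg
  set a := (Quot.out (e : Sym2 V)).1
  set b := (Quot.out (e : Sym2 V)).2
  have hab : (e : Sym2 V) = s(a, b) := edge_eq_out e
  have hadj : G.Adj a b := adj_out e
  have hκab : κ a b ≠ 1 := by
    simp only [hκdef, hab, if_true]
    decide
  refine ⟨fun u => if G.dist a u ≤ L ∧ geoTransport G κ a u = 1 then 1 else 0, ?_, ?_⟩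
  · rw [edgeCoboundary_apply _ e hab, if_pos ⟨by simp, geoTransport_self hG κ a⟩, if_neg]
    · rfl
    · rw [geoTransport_adj hG hκ hadj (hlt 2 (by omega))]
      exact fun h => hκab h.2
  · have key : ∀ x y, G.Adj x y → s(x, y) ≠ (e : Sym2 V) → G.dist a x < L →
        geoTransport G κ a x = 1 → G.dist a y ≤ L ∧ geoTransport G κ a y = 1 := by
      intro x y hxy hne hx hx'
      have hd : G.dist x y = 1 := dist_eq_one_iff_adj.mpr hxy
      have htri := hG.dist_triangle (u := a) (v := x) (w := y)
      refine ⟨by omega, ?_⟩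
      rw [← geoTransport_mul hG hκ (v := x) (hlt _ (by omega)), hx',
        geoTransport_adj hG hκ hxy (hlt 2 (by omega))]
      simp [hκdef, hne]
    intro e' hne hcob
    set x := (Quot.out (e' : Sym2 V)).1
    set y := (Quot.out (e' : Sym2 V)).2
    have hxy : (e' : Sym2 V) = s(x, y) := edge_eq_out e'
    have hadj' : G.Adj x y := adj_out e'
    have hne' : s(x, y) ≠ (e : Sym2 V) := fun h => hne (Subtype.ext (hxy.trans h))
    have hd : G.dist x y = 1 := dist_eq_one_iff_adj.mpr hadj'
    have htri := hG.dist_triangle (u := a) (v := x) (w := y)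
    rw [edgeCoboundary_apply _ e' hxy] at hcob
    by_contra! hlt'
    apply hcob
    -- Both ends of `e'` now lie in the ball of radius `L`, and crossing `e'` does not change the
    -- transport, so the two values of the cochain cancel.
    have hdy : G.dist a y ≤ L := by omega
    have hge : geoTransport G κ a y = geoTransport G κ a x := by
      rw [← geoTransport_mul hG hκ (v := x) (hlt _ (by omega)),
        geoTransport_adj hG hκ hadj' (hlt 2 (by omega))]
      simp [hκdef, hne']
    simp only [hge, hdy, hlt'.le, true_and]
    exact add_self_fin_two _

variable [DecidableRel G.Adj]

theorem vertexTerm_invariant {ψ : SpinSpace (OneCell G)}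
    (hA : ∀ s : ZeroCell G, (vertexTerm G s).app ψ = ψ) (s : ZeroCell G)
    (σ : OneCell G → Fin 2) : ψ (σ + spinIndicator (ZeroCell.star G s)) = ψ σ := by
  have h := congrArg (fun φ : SpinSpace (OneCell G) => φ σ) (hA s)
  simp only [vertexTerm, prodX_eq, shiftOp_app] at h
  exact h

/-- A cell vertex × edge has both or neither of its ends in the support of `α ∘ Prod.fst` and
cancels, while `e × {i}` collects the coboundary of `α` at `e`. Thus a product of vertex terms
realizes this shift. -/
theorem sum_spinIndicator_star (α : V → Fin 2) :
    ∑ s : V × V, (if α s.1 = 0 then 0 else spinIndicator (ZeroCell.star G s)) =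
      rowShift (edgeCoboundary G α) := by
  have h1 : ∀ (P : Prop) [Decidable P] (a : Fin 2),
      (if a = 0 then 0 else if P then (1 : Fin 2) else 0) = if P then a else 0 := by
    intro P _ a
    by_cases hP : P <;> simp only [hP, if_true, if_false]
    · fin_cases a <;> rfl
    · simp
  funext c
  rw [Finset.sum_apply, Fintype.sum_prod_type]
  have h2 : ∀ s : V × V, (if α s.1 = 0 then 0 else spinIndicator (ZeroCell.star G s) :
      OneCell G → Fin 2) c = if s ∈ OneCell.ends G c then α s.1 else 0 := by
    intro s
    rw [← h1]
    by_cases hs : α s.1 = 0 <;> simp [hs, spinIndicator, ZeroCell.star]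
  refine (Finset.sum_congr rfl fun u _ => Finset.sum_congr rfl fun i _ => h2 (u, i)).trans ?_
  rcases c with ⟨e, i⟩ | ⟨i, e⟩
  · simp only [OneCell.ends, Finset.mem_filter, Finset.mem_univ, true_and, rowShift,
      edgeCoboundary, AddMonoidHom.coe_mk, ZeroHom.coe_mk, Finset.sum_filter]
    refine Finset.sum_congr rfl fun u _ => ?_
    by_cases hu : u ∈ (e : Sym2 V) <;> simp [hu]
  · simp only [OneCell.ends, Finset.mem_filter, Finset.mem_univ, true_and, rowShift]
    refine Finset.sum_eq_zero fun u _ => ?_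
    by_cases hu : u = i
    · have := edgeCoboundary_apply (G := G) (fun _ => α u) e (edge_eq_out e)
      rw [add_self_fin_two] at this
      simpa [hu, edgeCoboundary, Finset.sum_filter] using this
    · simp [hu]

theorem coboundary_invariant {ψ : SpinSpace (OneCell G)}
    (hA : ∀ s : ZeroCell G, (vertexTerm G s).app ψ = ψ) (α : V → Fin 2)
    (σ : OneCell G → Fin 2) : ψ (σ + rowShift (edgeCoboundary G α)) = ψ σ := by
  let I : AddSubmonoid (OneCell G → Fin 2) :=
    { carrier := {χ | ∀ σ, ψ (σ + χ) = ψ σ}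
      zero_mem' := fun σ => by rw [add_zero]
      add_mem' := fun {χ χ'} h h' σ => by rw [← add_assoc, h', h] }
  have hmem : rowShift (edgeCoboundary G α) ∈ I := by
    rw [← sum_spinIndicator_star]
    refine I.sum_mem fun s _ => ?_
    split_ifs
    · exact I.zero_mem
    · exact vertexTerm_invariant hA s
  exact hmem σ

/-- The branch at `e` gives a product of vertex terms that splits into the shift on `e × V` and a
distant shift. Its expectation is one and factorizes, so each factor has expectation of modulus one.
-/
theorem norm_add_rowShift_single (hG : G.Connected) {R : ℕ}
    (hg : ((12 * R + 5 : ℕ) : ℕ∞) ≤ G.egirth) {ψ : SpinSpace (OneCell G)}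
    (hψ : IsTrivialState (cellGraph G) R ψ)
    (hA : ∀ s : ZeroCell G, (vertexTerm G s).app ψ = ψ) (e : G.edgeSet)
    (σ : OneCell G → Fin 2) : ‖ψ (σ + rowShift (Pi.single e 1))‖ = ‖ψ σ‖ := by
  -- 1-cells at distance `3 * R` project to vertices at distance at most `6 * R`. With `L = 6 * R +
  -- 1` the required girth `2 * L + 3` is `12 * R + 5`.
  obtain ⟨α, hα, hfar⟩ := exists_branch hG e (6 * R + 1) (by convert hg using 2; ring)
  set y := edgeCoboundary G α
  set z := y - Pi.single e 1
  have hyz : rowShift y = rowShift (Pi.single e 1) + rowShift z := by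
    rw [← rowShift_add, add_sub_cancel]
  have h1 : expect ψ.ofLp (shiftOp (rowShift y)) = 1 := by
    have h2 : expect ψ.ofLp (shiftOp (rowShift y)) = expect ψ.ofLp 1 := by
      rw [expect_shiftOp]
      simp [y, coboundary_invariant hA, expect, Matrix.one_apply]
    rw [h2, expect_one, hψ.1]
    simp
  rw [hyz, ← shiftOp_mul, hψ.expect_mul (S₁ := {c | rowShift (Pi.single e 1) c ≠ 0})
    (S₂ := {c | rowShift z c ≠ 0}) (shiftOp_actsOn fun c hc => by simpa using hc)
    (shiftOp_actsOn fun c hc => by simpa using hc)] at h1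
  · refine norm_add_eq_of_one_le hψ.1 ?_ σ
    have h2 := congrArg norm h1
    rw [norm_mul, norm_one] at h2
    calc (1 : ℝ) = _ := h2.symm
      _ ≤ _ := mul_le_of_le_one_right (norm_nonneg _) (norm_expect_shiftOp_le _ hψ.1)
  · rintro (⟨e₁, i⟩ | c) hc (⟨e', j⟩ | c') hc' hd
    · have he₁ : e₁ = e := by
        by_contra h
        exact hc (by simp [rowShift, h])
      subst he₁
      have hne : e' ≠ e₁ := by
        rintro rfl
        exact hc' (by simp [rowShift, z, hα])
      have hy : y e' ≠ 0 := by
        intro h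
        exact hc' (by simp [rowShift, z, h, hne])
      have h3 := hfar e' hne hy
      have h4 := dist_le_of_edist_cellGraph_le hG OneCell.fstVertex Prod.fst
        (fun c s h => OneCell.dist_fstVertex_le h) hd
      simp only [OneCell.fstVertex] at h4
      omega
    · exact hc' rfl
    · exact hc rfl
    · exact hc rfl

theorem norm_add_rowShift (hG : G.Connected) {R : ℕ}
    (hg : ((12 * R + 5 : ℕ) : ℕ∞) ≤ G.egirth) {ψ : SpinSpace (OneCell G)}
    (hψ : IsTrivialState (cellGraph G) R ψ)
    (hA : ∀ s : ZeroCell G, (vertexTerm G s).app ψ = ψ) (y : G.edgeSet → Fin 2)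
    (σ : OneCell G → Fin 2) : ‖ψ (σ + rowShift y)‖ = ‖ψ σ‖ := by
  let I : AddSubmonoid (G.edgeSet → Fin 2) :=
    { carrier := {y | ∀ σ, ‖ψ (σ + rowShift y)‖ = ‖ψ σ‖}
      zero_mem' := fun σ => by rw [rowShift_zero, add_zero]
      add_mem' := fun {y y'} h h' σ => by rw [rowShift_add, ← add_assoc, h', h] }
  have hmem : y ∈ I := by
    rw [← Finset.univ_sum_single y]
    refine I.sum_mem fun e _ => ?_
    have h01 : y e = 0 ∨ y e = 1 := by
      generalize y e = a
      fin_cases a <;> simp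
    rcases h01 with h | h
    · rw [h, Pi.single_zero]
      exact I.zero_mem
    · rw [h]
      exact norm_add_rowShift_single hG hg hψ hA e
  exact hmem σ

end RowShift

/-! ### Outcome probabilities in the configuration basis -/

section Prob

variable {Ω : Type*} [Fintype Ω]

open Classical in
/-- The probability of the event `E` for the weights `‖ξ σ‖ ^ 2`. -/
noncomputable def prob (ξ : Ω → ℂ) (E : Set Ω) : ℝ :=
  ∑ σ, if σ ∈ E then ‖ξ σ‖ ^ 2 else 0

theorem prob_nonneg (ξ : Ω → ℂ) (E : Set Ω) : 0 ≤ prob ξ E :=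
  Finset.sum_nonneg fun σ _ => by split_ifs <;> positivity

theorem prob_mono (ξ : Ω → ℂ) {E F : Set Ω} (h : E ⊆ F) : prob ξ E ≤ prob ξ F := by
  refine Finset.sum_le_sum fun σ _ => ?_
  by_cases hE : σ ∈ E
  · rw [if_pos hE, if_pos (h hE)]
  · rw [if_neg hE]
    split_ifs <;> positivity

theorem prob_univ (ξ : Ω → ℂ) : prob ξ Set.univ = ∑ σ, ‖ξ σ‖ ^ 2 := by
  simp [prob]

theorem prob_iUnion_le {ι : Type*} (s : Finset ι) (ξ : Ω → ℂ) (E : ι → Set Ω) :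
    prob ξ (⋃ i ∈ s, E i) ≤ ∑ i ∈ s, prob ξ (E i) := by
  simp only [prob]
  rw [Finset.sum_comm]
  refine Finset.sum_le_sum fun σ _ => ?_
  split_ifs with h
  · simp only [Set.mem_iUnion] at h
    obtain ⟨i, hi, hσ⟩ := h
    refine le_trans ?_ (Finset.single_le_sum (fun j _ => ?_) hi)
    · rw [if_pos hσ]
    · split_ifs <;> positivity
  · exact Finset.sum_nonneg fun i _ => by split_ifs <;> positivity

theorem prob_mul_le (ξ : Ω → ℂ) {f : Ω → ℝ} (hf : ∀ σ, 0 ≤ f σ) (c : ℝ) {E : Set Ω}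
    (hE : ∀ σ ∈ E, c ≤ f σ) : c * prob ξ E ≤ ∑ σ, ‖ξ σ‖ ^ 2 * f σ := by
  rw [prob, Finset.mul_sum]
  refine Finset.sum_le_sum fun σ _ => ?_
  split_ifs with h
  · rw [mul_comm]
    exact mul_le_mul_of_nonneg_left (hE σ h) (by positivity)
  · rw [mul_zero]
    exact mul_nonneg (by positivity) (hf σ)

theorem sum_mul_indicator (ξ : Ω → ℂ) (E : Set Ω) [DecidablePred (· ∈ E)] :
    ∑ σ, ‖ξ σ‖ ^ 2 * (if σ ∈ E then 1 else 0) = prob ξ E :=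
  Finset.sum_congr rfl fun σ _ => by by_cases h : σ ∈ E <;> simp [h]

open Classical in
/-- Chebyshev's inequality for a sum of pairwise independent events of equal probability. -/
theorem chebyshev_count {N : ℕ} (ξ : Ω → ℂ) (h1 : prob ξ Set.univ = 1) (E : Fin N → Set Ω)
    {p : ℝ} (hp : ∀ k, prob ξ (E k) = p)
    (hpair : ∀ k l, k ≠ l → prob ξ (E k ∩ E l) = p * p) {c : ℝ} (hc : 0 < c) :
    prob ξ {σ | N * p + c ≤ (Finset.univ.filter fun k => σ ∈ E k).card} ≤ N * p / c ^ 2 := by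
  set g : Fin N → Ω → ℝ := fun k σ => if σ ∈ E k then 1 else 0
  have hcard : ∀ σ, ((Finset.univ.filter fun k => σ ∈ E k).card : ℝ) = ∑ k, g k σ := by
    intro σ
    simp [g]
  have hgg : ∀ k l σ, g k σ * g l σ = if σ ∈ E k ∩ E l then 1 else 0 := by
    intro k l σ
    by_cases hk : σ ∈ E k <;> by_cases hl : σ ∈ E l <;> simp [g, hk, hl]
  have hp0 : 0 ≤ (N : ℝ) * p := by
    rcases Nat.eq_zero_or_pos N with h | h
    · simp [h]
    · exact mul_nonneg (by positivity) ((hp ⟨0, h⟩) ▸ prob_nonneg ξ _)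
  have hmean : ∑ σ, ‖ξ σ‖ ^ 2 * ∑ k, g k σ = N * p := by
    simp only [Finset.mul_sum]
    rw [Finset.sum_comm]
    simp only [g, sum_mul_indicator, hp]
    simp
  have hsq : ∑ σ, ‖ξ σ‖ ^ 2 * (∑ k, g k σ) ^ 2 = N * p + (N * (N - 1)) * (p * p) := by
    have hE : ∀ σ, (∑ k, g k σ) ^ 2 = ∑ k, ∑ l, if σ ∈ E k ∩ E l then 1 else 0 := by
      intro σ
      rw [sq, Finset.sum_mul_sum]
      simp only [hgg]
    simp only [hE, Finset.mul_sum]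
    rw [Finset.sum_comm]
    have : ∀ k : Fin N, ∑ σ, ∑ l, ‖ξ σ‖ ^ 2 * (if σ ∈ E k ∩ E l then 1 else 0) =
        p + (N - 1) * (p * p) := by
      intro k
      rw [Finset.sum_comm]
      simp only [sum_mul_indicator]
      rw [← Finset.add_sum_erase _ _ (Finset.mem_univ k), Set.inter_self, hp,
        Finset.sum_congr rfl fun l hl => hpair k l (Finset.ne_of_mem_erase hl).symm]
      rw [Finset.sum_const, Finset.card_erase_of_mem (Finset.mem_univ k), Finset.card_univ,
        Fintype.card_fin, nsmul_eq_mul, Nat.cast_sub (by have := k.2; omega)]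
      simp
    simp only [this]
    rw [Finset.sum_const, Finset.card_univ, Fintype.card_fin, nsmul_eq_mul]
    ring
  have htot : ∑ σ, ‖ξ σ‖ ^ 2 = 1 := by rw [← prob_univ, h1]
  have hvar : ∑ σ, ‖ξ σ‖ ^ 2 * (∑ k, g k σ - N * p) ^ 2 ≤ N * p := by
    have e : ∑ σ, ‖ξ σ‖ ^ 2 * (∑ k, g k σ - N * p) ^ 2 =
        ∑ σ, ‖ξ σ‖ ^ 2 * (∑ k, g k σ) ^ 2 - 2 * (N * p) * ∑ σ, ‖ξ σ‖ ^ 2 * ∑ k, g k σ +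
          (N * p) ^ 2 * ∑ σ, ‖ξ σ‖ ^ 2 := by
      rw [Finset.mul_sum, Finset.mul_sum, ← Finset.sum_sub_distrib, ← Finset.sum_add_distrib]
      exact Finset.sum_congr rfl fun σ _ => by ring
    rw [e, hsq, hmean, htot]
    have : 0 ≤ N * (p * p) := mul_nonneg (by positivity) (mul_self_nonneg p)
    nlinarith
  rw [le_div_iff₀ (by positivity), mul_comm]
  refine le_trans (prob_mul_le ξ (f := fun σ => (∑ k, g k σ - N * p) ^ 2)
    (fun σ => sq_nonneg _) (c ^ 2) fun σ hσ => ?_) hvar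
  have hσ' : N * p + c ≤ ∑ k, g k σ := by
    rw [← hcard]
    exact hσ
  exact pow_le_pow_left₀ hc.le (by linarith) 2

end Prob

section ProjOp

variable {Q : Type*} [Fintype Q]

open Classical in
/-- The projection to the configurations in `E`. -/
noncomputable def projOp (E : Set (Q → Fin 2)) : SpinOp Q :=
  Matrix.diagonal fun σ => if σ ∈ E then 1 else 0

theorem liftOp_projOp {N : ℕ} (h : Q → Equiv.Perm (Fin N)) (E : Fin N → Set (Q → Fin 2)) :
    liftOp h (fun k => projOp (E k)) = projOp {σ | ∀ k, sheet h k σ ∈ E k} := by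
  classical
  ext σ τ
  by_cases hst : σ = τ
  · subst hst
    simp only [liftOp, projOp, Matrix.diagonal_apply_eq]
    by_cases hσ : ∀ k, sheet h k σ ∈ E k
    · simp [hσ]
    · rw [if_neg (by exact hσ)]
      push Not at hσ
      obtain ⟨k, hk⟩ := hσ
      exact Finset.prod_eq_zero (Finset.mem_univ k) (if_neg hk)
  · rw [projOp, Matrix.diagonal_apply_ne _ hst]
    obtain ⟨x, hx⟩ := Function.ne_iff.mp hst
    refine Finset.prod_eq_zero (Finset.mem_univ ((h x.1).symm x.2)) ?_
    exact Matrix.diagonal_apply_ne _ (Function.ne_iff.mpr ⟨x.1, by simpa [sheet] using hx⟩)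

variable [DecidableEq Q]

theorem prob_univ_eq (ψ : SpinSpace Q) : prob ψ.ofLp Set.univ = ‖ψ‖ ^ 2 := by
  rw [prob_univ, EuclideanSpace.norm_sq_eq]

theorem expect_diagonal (ξ : (Q → Fin 2) → ℂ) (f : (Q → Fin 2) → ℝ) :
    expect ξ (Matrix.diagonal fun σ => (f σ : ℂ)) = ((∑ σ, ‖ξ σ‖ ^ 2 * f σ : ℝ) : ℂ) := by
  simp only [expect, Complex.ofReal_sum]
  refine Finset.sum_congr rfl fun σ _ => ?_
  rw [Finset.sum_eq_single σ]
  · rw [Matrix.diagonal_apply_eq, mul_right_comm]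
    simp [Complex.conj_mul']
  · intro τ _ h
    rw [Matrix.diagonal_apply_ne' _ h, mul_zero, zero_mul]
  · simp

theorem expect_projOp (ξ : (Q → Fin 2) → ℂ) (E : Set (Q → Fin 2)) :
    expect ξ (projOp E) = (prob ξ E : ℂ) := by
  classical
  rw [← sum_mul_indicator, ← expect_diagonal]
  congr 1
  rw [projOp]
  congr 1
  funext σ
  split_ifs <;> simp

theorem projOp_actsOn {S : Set Q} {E : Set (Q → Fin 2)}
    (hE : ∀ χ : Q → Fin 2, (∀ q ∈ S, χ q = 0) → ∀ σ, σ + χ ∈ E ↔ σ ∈ E) :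
    SpinOp.ActsOn S (projOp E) :=
  by classical exact SpinOp.ActsOn.diagonal fun χ hχ σ => if_congr (hE χ hχ σ) rfl rfl

end ProjOp

/-! ### Fluxes and cohomology classes -/

section Flux

open SimpleGraph

variable {V : Type*} [Fintype V] [DecidableEq V] {G : SimpleGraph V}

/-- The coboundary of the configuration `σ`, evaluated on a plaquette. -/
def flux (σ : OneCell G → Fin 2) (p : TwoCell G) : Fin 2 :=
  ∑ c ∈ TwoCell.boundary G p, σ c

/-- The first cohomology group of `G` with coefficients in `ℤ/2`. -/
abbrev EdgeClass (G : SimpleGraph V) : Type _ :=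
  (G.edgeSet → Fin 2) ⧸ (edgeCoboundary G).range

/-- The cohomology class of the restriction of `σ` to `G × {v}`. -/
def edgeClass (v : V) (σ : OneCell G → Fin 2) : EdgeClass G :=
  QuotientAddGroup.mk fun e => σ (.inl (e, v))

theorem flux_eq (σ : OneCell G → Fin 2) (e f : G.edgeSet) {v w : V}
    (hf : (f : Sym2 V) = s(v, w)) :
    flux σ (e, f) = σ (.inl (e, v)) + σ (.inl (e, w)) +
      edgeCoboundary G (fun i => σ (.inr (i, f))) e := by
  have h := edgeCoboundary_apply (fun i => σ (.inl (e, i))) f hf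
  rw [← h]
  simp [flux, TwoCell.boundary, Finset.sum_disjSum, edgeCoboundary]

/-- The sides `{j} × f` of the squares over `f` contribute a coboundary of `G`, which vanishes in
cohomology. -/
theorem edgeClass_add_edgeClass (σ : OneCell G → Fin 2) (f : G.edgeSet) {v w : V}
    (hf : (f : Sym2 V) = s(v, w)) :
    edgeClass v σ + edgeClass w σ = QuotientAddGroup.mk fun e => flux σ (e, f) := by
  have h : (fun e => flux σ (e, f)) = (fun e => σ (.inl (e, v))) + (fun e => σ (.inl (e, w))) +
      edgeCoboundary G (fun i => σ (.inr (i, f))) := by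
    funext e
    exact flux_eq σ e f hf
  rw [h, QuotientAddGroup.mk_add, QuotientAddGroup.mk_add,
    (QuotientAddGroup.eq_zero_iff (edgeCoboundary G fun i => σ (.inr (i, f)))).mpr
      (AddMonoidHom.mem_range.mpr ⟨_, rfl⟩),
    add_zero]
  rfl

theorem edgeClass_add_of_eq_zero {v : V} {χ : OneCell G → Fin 2}
    (hχ : ∀ e, χ (.inl (e, v)) = 0) (σ : OneCell G → Fin 2) :
    edgeClass v (σ + χ) = edgeClass v σ := by
  simp [edgeClass, hχ]

open Classical in
/-- The cohomology classes of the `1`-cochains with at most `k` nonzero values. -/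
noncomputable def lightClasses (G : SimpleGraph V) [DecidableRel G.Adj] (k : ℕ) :
    Finset (EdgeClass G) :=
  ((Finset.univ : Finset (G.edgeSet → Fin 2)).filter fun y =>
    (Finset.univ.filter fun e => y e ≠ 0).card ≤ k).image QuotientAddGroup.mk

variable [DecidableRel G.Adj]

theorem re_inner_plaquetteHamiltonian (ψ : SpinSpace (OneCell G)) (hψ : ‖ψ‖ = 1) :
    (inner ℂ ψ ((plaquetteHamiltonian G).app ψ)).re =
      2 * ∑ p : TwoCell G, prob ψ.ofLp {σ | flux σ p ≠ 0} - Fintype.card (TwoCell G) := by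
  have hsum : ∀ (s : Finset (TwoCell G)) (T : TwoCell G → SpinOp (OneCell G)),
      expect ψ.ofLp (-∑ p ∈ s, T p) = -∑ p ∈ s, expect ψ.ofLp (T p) := by
    intro s T
    simp only [expect, Matrix.neg_apply, Matrix.sum_apply, mul_neg, neg_mul, Finset.sum_neg_distrib,
      Finset.mul_sum, Finset.sum_mul, neg_inj]
    refine Eq.trans (Finset.sum_congr rfl fun σ _ => ?_) Finset.sum_comm
    exact Finset.sum_comm
  have hp : ∀ p : TwoCell G, (expect ψ.ofLp (plaquetteTerm G p)).re =
      1 - 2 * prob ψ.ofLp {σ | flux σ p ≠ 0} := by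
    intro p
    classical
    rw [plaquetteTerm, prodZ_eq, expect_diagonal, Complex.ofReal_re, ← sum_mul_indicator]
    have h1 : ∑ σ, ‖ψ σ‖ ^ 2 = 1 := by rw [← EuclideanSpace.norm_sq_eq, hψ, one_pow]
    have h2 : ∀ u : ℝ, 1 - u = ∑ σ, ‖ψ σ‖ ^ 2 - u := fun u => by rw [h1]
    rw [h2, Finset.mul_sum, ← Finset.sum_sub_distrib]
    refine Finset.sum_congr rfl fun σ _ => ?_
    have hs : ∀ a : Fin 2, spinSign a = 1 - 2 * (if a ≠ 0 then 1 else 0) := by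
      intro a
      fin_cases a <;> norm_num [spinSign]
    change ‖ψ σ‖ ^ 2 * spinSign (flux σ p) = _
    rw [hs]
    simp only [Set.mem_ofPred_eq]
    ring
  rw [inner_app, plaquetteHamiltonian, hsum, Complex.neg_re, Complex.re_sum]
  simp only [hp]
  rw [Finset.sum_sub_distrib, Finset.mul_sum]
  simp

/-- The shifts `rowShift y` preserve the weights and translate the class over `v` by an arbitrary
element. -/
theorem prob_edgeClass {ψ : SpinSpace (OneCell G)} (hψ : ‖ψ‖ = 1)
    (hinv : ∀ (y : G.edgeSet → Fin 2) σ, ‖ψ (σ + rowShift y)‖ = ‖ψ σ‖) (v : V)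
    (x : EdgeClass G) :
    prob ψ.ofLp {σ | edgeClass v σ = x} = 1 / Nat.card (EdgeClass G) := by
  classical
  have hconst : ∀ x', prob ψ.ofLp {σ | edgeClass v σ = x'} =
      prob ψ.ofLp {σ | edgeClass v σ = x} := by
    intro x'
    obtain ⟨y, hy⟩ := QuotientAddGroup.mk_surjective (x' - x)
    rw [prob, prob, ← Equiv.sum_comp (Equiv.addRight (rowShift y))]
    refine Finset.sum_congr rfl fun σ _ => ?_
    have h : edgeClass v (σ + rowShift y) = edgeClass v σ + (x' - x) := by
      rw [← hy]
      rfl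
    simp only [Equiv.coe_addRight, Set.mem_ofPred_eq, h, hinv]
    have : edgeClass v σ + (x' - x) = x' ↔ edgeClass v σ = x := by
      rw [← eq_sub_iff_add_eq, sub_sub_cancel]
    simp only [this]
  have hsum : ∑ x', prob ψ.ofLp {σ | edgeClass v σ = x'} = 1 := by
    have h1 : ∑ σ, ‖ψ σ‖ ^ 2 = 1 := by rw [← EuclideanSpace.norm_sq_eq, hψ, one_pow]
    simp only [prob]
    rw [Finset.sum_comm, ← h1]
    refine Finset.sum_congr rfl fun σ _ => ?_
    simp
  simp only [hconst] at hsum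
  rw [Finset.sum_const, Finset.card_univ, nsmul_eq_mul] at hsum
  rw [Nat.card_eq_fintype_card]
  have h0 : (Fintype.card (EdgeClass G) : ℝ) ≠ 0 := by
    intro h
    rw [h, zero_mul] at hsum
    exact zero_ne_one hsum
  field_simp
  linarith

/-- Markov's inequality: unless at least `k + 1` squares over `f` carry flux, the flux itself is a
light representative of the sum of the classes. -/
theorem prob_notMem_lightClasses (ψ : SpinSpace (OneCell G)) (k : ℕ) (f : G.edgeSet)
    {v w : V} (hf : (f : Sym2 V) = s(v, w)) :
    (k + 1) * prob ψ.ofLp {σ | edgeClass v σ + edgeClass w σ ∉ lightClasses G k} ≤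
      ∑ e, prob ψ.ofLp {σ | flux σ (e, f) ≠ 0} := by
  classical
  refine (prob_mul_le ψ.ofLp (f := fun σ => ∑ e : G.edgeSet, if flux σ (e, f) ≠ 0 then 1 else 0)
    (fun σ => Finset.sum_nonneg fun e _ => by split_ifs <;> norm_num) _ fun σ hσ => ?_).trans_eq ?_
  · by_contra! hlt
    apply hσ
    rw [edgeClass_add_edgeClass σ f hf]
    refine Finset.mem_image_of_mem _ (Finset.mem_filter.mpr ⟨Finset.mem_univ _, ?_⟩)
    rw [Finset.sum_boole] at hlt
    exact Nat.lt_succ_iff.mp (by exact_mod_cast hlt)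
  · simp only [Finset.mul_sum]
    rw [Finset.sum_comm]
    exact Finset.sum_congr rfl fun e _ =>
      sum_mul_indicator ψ.ofLp {σ | flux σ (e, f) ≠ 0}

end Flux

/-! ### Labellings of the lifts of a graph -/

section Labelling

open SimpleGraph

variable {V : Type*} [DecidableEq V] {G : SimpleGraph V} {N : ℕ}

open Classical in
/-- The connection on `G` given by a permutation for each edge, with the orientation of the edge
from its first to its second representative. -/
noncomputable def edgeConnection (π : G.edgeSet → Equiv.Perm (Fin N)) (u v : V) :
    Equiv.Perm (Fin N) :=
  let ρ : Equiv.Perm (Fin N) := if h : s(u, v) ∈ G.edgeSet then π ⟨s(u, v), h⟩ else 1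
  if (Quot.out s(u, v)).1 = u then ρ else ρ⁻¹

theorem edgeConnection_mul (π : G.edgeSet → Equiv.Perm (Fin N)) (u v : V) (h : G.Adj u v) :
    edgeConnection π v u * edgeConnection π u v = 1 := by
  have hmem : (Quot.out s(u, v)).1 = u ∨ (Quot.out s(u, v)).1 = v := by
    have h1 : (Quot.out s(u, v)).1 ∈ s((Quot.out s(u, v)).1, (Quot.out s(u, v)).2) := by simp
    have h2 : s((Quot.out s(u, v)).1, (Quot.out s(u, v)).2) = s(u, v) := Quot.out_eq s(u, v)
    rw [h2, Sym2.mem_iff] at h1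
    exact h1
  simp only [edgeConnection]
  rw [Sym2.eq_swap (a := v) (b := u)]
  rcases hmem with hm | hm <;> simp [hm, h, h.ne, h.ne.symm]

theorem edgeConnection_out (π : G.edgeSet → Equiv.Perm (Fin N)) (f : G.edgeSet) :
    edgeConnection π (Quot.out (f : Sym2 V)).1 (Quot.out (f : Sym2 V)).2 = π f := by
  simp only [edgeConnection]
  rw [← edge_eq_out f]
  simp

variable [Fintype V]

/-- The cohomology class of the restriction of a configuration of `N` copies of `G × G` to the
`k`-th copy of `G × {v}`. -/
def sheetClass (v : V) (k : Fin N) (σ : OneCell G × Fin N → Fin 2) : EdgeClass G :=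
  QuotientAddGroup.mk fun e => σ (.inl (e, v), k)

/-- The gates are glued by parallel transport from a base spin in their support, and the observable
by transport from `v`. In the light cone of the cells over `v` and `w` the two gluings differ by one
permutation per gate, because triangles there are shorter than the girth. The state `Ψ` serves all
`v` and `w` at once. -/
theorem exists_prob_lift [DecidableRel G.Adj] (hG : G.Connected) {R : ℕ}
    (hg : ((12 * R + 5 : ℕ) : ℕ∞) ≤ G.egirth) {ψ : SpinSpace (OneCell G)}
    (hψ : IsTrivialState (cellGraph G) R ψ)
    (π : G.edgeSet → Equiv.Perm (Fin N)) :
    ∃ Ψ : (OneCell G × Fin N → Fin 2) → ℂ, ∀ v w : V, (v = w ∨ G.Adj v w) →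
      ∀ P : Fin N → EdgeClass G → EdgeClass G → Prop,
      prob Ψ {σ | ∀ k, P k (sheetClass v k σ)
          (sheetClass w (geoTransport G (edgeConnection π) v w k) σ)} =
        ∏ k, prob ψ.ofLp {σ | P k (edgeClass v σ) (edgeClass w σ)} := by
  classical
  set κ := edgeConnection π
  have hκ : ∀ u v, G.Adj u v → κ v u * κ u v = 1 := edgeConnection_mul π
  obtain ⟨Ψ, hΨ⟩ := hψ.exists_lift (N := N) fun s q =>
    if hs : s.Nonempty then geoTransport G κ (OneCell.sndVertex hs.choose) (OneCell.sndVertex q)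
    else 1
  refine ⟨Ψ, fun v w hvw P => ?_⟩
  set S : Set (OneCell G) := {c | ∃ e, c = .inl (e, v) ∨ c = .inl (e, w)} with hS
  have hdist : G.dist v w ≤ 1 := by
    rcases hvw with h | h
    · simp [h]
    · exact (dist_eq_one_iff_adj.mpr h).le
  have hSd : ∀ c ∈ spinNhd (cellGraph G) R S, G.dist v (OneCell.sndVertex c) ≤ 2 * R + 1 := by
    rintro c ⟨c', ⟨e, hc'⟩, hcc'⟩
    have h1 := dist_le_of_edist_cellGraph_le hG OneCell.sndVertex Prod.snd
      (fun c s h => OneCell.dist_sndVertex_le h) hcc'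
    have h2 : G.dist v (OneCell.sndVertex c') ≤ 1 := by
      rcases hc' with h | h <;> simp [h, OneCell.sndVertex, hdist]
    have h3 := hG.dist_triangle (u := v) (v := OneCell.sndVertex c') (w := OneCell.sndVertex c)
    omega
  have key := hΨ (fun q => geoTransport G κ v (OneCell.sndVertex q)) S
    (fun k => projOp {σ | P k (edgeClass v σ) (edgeClass w σ)}) (fun k => projOp_actsOn
      fun χ hχ σ => by
        have hv := edgeClass_add_of_eq_zero (v := v) (fun e => hχ _ ⟨e, Or.inl rfl⟩) σ
        have hw := edgeClass_add_of_eq_zero (v := w) (fun e => hχ _ ⟨e, Or.inr rfl⟩) σ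
        simp only [Set.mem_ofPred_eq, hv, hw]) ?_
  · simp only [liftOp_projOp, expect_projOp] at key
    have h1 : ∀ k (σ : OneCell G × Fin N → Fin 2),
        edgeClass v (sheet (fun q => geoTransport G κ v (OneCell.sndVertex q)) k σ) =
          sheetClass v k σ := by
      intro k σ
      simp [edgeClass, sheetClass, sheet, OneCell.sndVertex, geoTransport_self hG]
    have h2 : ∀ k (σ : OneCell G × Fin N → Fin 2),
        edgeClass w (sheet (fun q => geoTransport G κ v (OneCell.sndVertex q)) k σ) =
          sheetClass w (geoTransport G κ v w k) σ := fun k σ => rfl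
    simp only [Set.mem_ofPred_eq, h1, h2] at key
    exact_mod_cast key
  · intro s hs hd
    by_cases hne : s.Nonempty
    · refine ⟨geoTransport G κ v (OneCell.sndVertex hne.choose), fun q hq => ?_⟩
      rw [dif_pos hne]
      refine (geoTransport_mul hG hκ ?_).symm
      have h1 := hSd _ (hs hne.choose_spec)
      have h2 := hSd _ (hs hq)
      have h3 := dist_le_of_edist_cellGraph_le hG OneCell.sndVertex Prod.snd
        (fun c s h => OneCell.dist_sndVertex_le h)
        ((edist_le_setDiam (cellGraph G) hne.choose_spec hq).trans hd)
      -- The sides are at most `2 * R + 1`, `2 * R` and `2 * R + 1`, in total `6 * R + 2`.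
      refine lt_of_lt_of_le ?_ hg
      exact_mod_cast (by omega)
    · exact ⟨1, fun q hq => absurd ⟨q, hq⟩ hne⟩

-- Only `T` with at most two elements enters: the empty set gives normalization, the pairs give
-- pairwise independence.
open Classical in
theorem chebyshev_lift {Ω Ω' : Type*} [Fintype Ω] [Fintype Ω'] (Ψ : Ω → ℂ) (ξ : Ω' → ℂ)
    (E : Fin N → Set Ω) (F : Set Ω')
    (h : ∀ T : Finset (Fin N), prob Ψ {σ | ∀ k ∈ T, σ ∈ E k} = prob ξ F ^ T.card)
    {c : ℝ} (hc : 0 < c) :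
    prob Ψ {σ | N * prob ξ F + c ≤ (Finset.univ.filter fun k => σ ∈ E k).card} ≤
      N * prob ξ F / c ^ 2 := by
  refine chebyshev_count Ψ ?_ E (fun k => ?_) (fun k l hkl => ?_) hc
  · simpa using h ∅
  · simpa using h {k}
  · have := h {k, l}
    rw [Finset.card_pair hkl, sq] at this
    rw [← this]
    congr 1
    ext σ
    simp

variable [DecidableRel G.Adj]

open Classical in
/-- For every choice of permutations there is a labelling of the corresponding lift of `G` by
cohomology classes that is nearly equidistributed, and nearly constant along most edges. -/
theorem exists_labelling (hG : G.Connected) {R : ℕ}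
    (hg : ((12 * R + 5 : ℕ) : ℕ∞) ≤ G.egirth) {ψ : SpinSpace (OneCell G)}
    (hψ : IsTrivialState (cellGraph G) R ψ)
    (hinv : ∀ (y : G.edgeSet → Fin 2) σ, ‖ψ (σ + rowShift y)‖ = ‖ψ σ‖)
    (Y : Finset (EdgeClass G)) (F : Finset G.edgeSet)
    (hF : ∀ f ∈ F, prob ψ.ofLp {σ | edgeClass (Quot.out (f : Sym2 V)).1 σ +
      edgeClass (Quot.out (f : Sym2 V)).2 σ ∉ Y} ≤ 1 / 32)
    (hN : Fintype.card V * Nat.card (EdgeClass G) ^ 2 + 32 * F.card < N)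
    (π : G.edgeSet → Equiv.Perm (Fin N)) :
    ∃ X : V → Fin N → EdgeClass G,
      (∀ v x, Nat.card (EdgeClass G) * (Finset.univ.filter fun k => X v k = x).card ≤ 2 * N) ∧
      ∀ f ∈ F, 16 * (Finset.univ.filter fun k => X (Quot.out (f : Sym2 V)).1 k +
        X (Quot.out (f : Sym2 V)).2 (π f k) ∉ Y).card ≤ N := by
  obtain ⟨Ψ, hΨ⟩ := exists_prob_lift hG hg hψ π
  set M := Nat.card (EdgeClass G) with hM
  have hMpos : 0 < M := Nat.card_pos
  have hM0 : (0 : ℝ) < M := by exact_mod_cast hMpos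
  have hNpos : 0 < N := lt_of_le_of_lt (Nat.zero_le _) hN
  have hN0 : (0 : ℝ) < N := by exact_mod_cast hNpos
  have hone : prob ψ.ofLp Set.univ = 1 := by rw [prob_univ_eq, hψ.1, one_pow]
  have hprod : ∀ v w : V, (v = w ∨ G.Adj v w) → ∀ (P : EdgeClass G → EdgeClass G → Prop)
      (T : Finset (Fin N)),
      prob Ψ {σ | ∀ k ∈ T, P (sheetClass v k σ)
          (sheetClass w (geoTransport G (edgeConnection π) v w k) σ)} =
        prob ψ.ofLp {σ | P (edgeClass v σ) (edgeClass w σ)} ^ T.card := by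
    intro v w hvw P T
    refine (hΨ v w hvw fun k x y => k ∈ T → P x y).trans ?_
    rw [← Finset.prod_const, ← Finset.prod_subset (Finset.subset_univ T)]
    · exact Finset.prod_congr rfl fun k hk => by simp [hk]
    · intro k _ hk
      simpa [hk] using hone
  -- The means are `N / M` and at most `N / 32`, and the deviations `N / M` and `N / 32`. Chebyshev
  -- gives probabilities at most `M / N` and `32 / N`, whose sum is below one by `hN`; avoiding the
  -- events gives the bounds `2 * N / M` and `N / 16`.
  let bad : (V × EdgeClass G) ⊕ G.edgeSet → Set (OneCell G × Fin N → Fin 2)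
    | .inl (v, x) => {σ | N * (1 / M : ℝ) + N / M ≤
        (Finset.univ.filter fun k => sheetClass v k σ = x).card}
    | .inr f => {σ | N * prob ψ.ofLp {σ | edgeClass (Quot.out (f : Sym2 V)).1 σ +
          edgeClass (Quot.out (f : Sym2 V)).2 σ ∉ Y} + N / 32 ≤
        (Finset.univ.filter fun k => sheetClass (Quot.out (f : Sym2 V)).1 k σ +
          sheetClass (Quot.out (f : Sym2 V)).2 (π f k) σ ∉ Y).card}
  have hbad₁ : ∀ z : V × EdgeClass G, prob Ψ (bad (.inl z)) ≤ M / N := by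
    rintro ⟨v, x⟩
    have hp : prob ψ.ofLp {σ | edgeClass v σ = x} = 1 / M := prob_edgeClass hψ.1 hinv v x
    have := chebyshev_lift Ψ ψ.ofLp (fun k => {σ | sheetClass v k σ = x})
      {σ | edgeClass v σ = x} (fun T => hprod v v (Or.inl rfl) (fun y _ => y = x) T)
      (div_pos hN0 hM0)
    rw [hp] at this
    refine (le_of_eq ?_).trans (this.trans_eq ?_)
    · simp only [bad]
      congr!
    · field_simp
  have hbad₂ : ∀ f ∈ F, prob Ψ (bad (.inr f)) ≤ 32 / N := by
    intro f hf
    have := chebyshev_lift Ψ ψ.ofLp (fun k => {σ | sheetClass (Quot.out (f : Sym2 V)).1 k σ +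
        sheetClass (Quot.out (f : Sym2 V)).2 (π f k) σ ∉ Y})
      {σ | edgeClass (Quot.out (f : Sym2 V)).1 σ + edgeClass (Quot.out (f : Sym2 V)).2 σ ∉ Y}
      (fun T => ?_) (div_pos hN0 (by norm_num : (0 : ℝ) < 32))
    · refine (le_of_eq ?_).trans (this.trans ?_)
      · simp only [bad]
        congr!
      rw [div_le_div_iff₀ (by positivity) hN0]
      have h := hF f hf
      have h2 : (N : ℝ) * prob ψ.ofLp {σ | edgeClass (Quot.out (f : Sym2 V)).1 σ +
          edgeClass (Quot.out (f : Sym2 V)).2 σ ∉ Y} * N ≤ N * (1 / 32) * N := by gcongr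
      refine h2.trans_eq ?_
      ring
    · have := hprod _ _ (Or.inr (adj_out f)) (fun x y => x + y ∉ Y) T
      rw [geoTransport_adj hG (edgeConnection_mul π) (adj_out f)
        (lt_of_lt_of_le (by exact_mod_cast (by omega)) hg), edgeConnection_out] at this
      exact this
  have hex : ∃ σ, ∀ i ∈ Finset.univ.disjSum F, σ ∉ bad i := by
    by_contra! hall
    have h1 : prob Ψ Set.univ = 1 := by
      have := hΨ hG.nonempty.some hG.nonempty.some (Or.inl rfl) fun _ _ _ => True
      simpa [hone] using this
    have h2 : prob Ψ Set.univ ≤ ∑ i ∈ Finset.univ.disjSum F, prob Ψ (bad i) := by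
      refine (prob_mono Ψ fun σ _ => ?_).trans (prob_iUnion_le _ Ψ bad)
      obtain ⟨i, hi, hσ⟩ := hall σ
      exact Set.mem_biUnion hi hσ
    rw [Finset.sum_disjSum, h1] at h2
    have h3 := Finset.sum_le_card_nsmul Finset.univ (fun z => prob Ψ (bad (.inl z))) _
      fun z _ => hbad₁ z
    have h4 := Finset.sum_le_card_nsmul F (fun f => prob Ψ (bad (.inr f))) _ hbad₂
    rw [Finset.card_univ, Fintype.card_prod, ← Nat.card_eq_fintype_card (α := EdgeClass G), ← hM,
      nsmul_eq_mul] at h3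
    rw [nsmul_eq_mul] at h4
    have h5 : (1 : ℝ) ≤ (Fintype.card V * M : ℕ) * (M / N) + F.card * (32 / N) := by linarith
    have h6 : ((Fintype.card V * M : ℕ) * (M / N) + F.card * (32 / N) : ℝ) =
        (Fintype.card V * M ^ 2 + 32 * F.card) / N := by
      push_cast
      field_simp
    rw [h6, le_div_iff₀ hN0, one_mul] at h5
    have h7 : ((Fintype.card V * M ^ 2 + 32 * F.card : ℕ) : ℝ) < N := by exact_mod_cast hN
    push_cast at h7
    linarith
  obtain ⟨σ, hσ⟩ := hex
  refine ⟨fun v k => sheetClass v k σ, fun v x => ?_, fun f hf => ?_⟩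
  · have h : ¬ (N * (1 / M : ℝ) + N / M ≤
        (Finset.univ.filter fun k => sheetClass v k σ = x).card) :=
      hσ (.inl (v, x)) (by simp)
    rw [not_le] at h
    have h2 := mul_lt_mul_of_pos_left h hM0
    have h3 : (M : ℝ) * (N * (1 / M : ℝ) + N / M) = 2 * N := by field_simp; ring
    rw [h3] at h2
    exact_mod_cast h2.le
  · have h : ¬ (N * prob ψ.ofLp {σ | edgeClass (Quot.out (f : Sym2 V)).1 σ +
          edgeClass (Quot.out (f : Sym2 V)).2 σ ∉ Y} + N / 32 ≤
        (Finset.univ.filter fun k => sheetClass (Quot.out (f : Sym2 V)).1 k σ +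
          sheetClass (Quot.out (f : Sym2 V)).2 (π f k) σ ∉ Y).card) :=
      hσ (.inr f) (by simp [hf])
    rw [not_le] at h
    have h2 := mul_le_mul_of_nonneg_left (hF f hf) hN0.le
    have h3 : (16 : ℝ) * (Finset.univ.filter fun k => sheetClass (Quot.out (f : Sym2 V)).1 k σ +
          sheetClass (Quot.out (f : Sym2 V)).2 (π f k) σ ∉ Y).card ≤ N := by linarith
    exact_mod_cast h3

end Labelling

/-! ### Counting lifts -/

section Counting

theorem pow_le_factorial_mul (N : ℕ) : (N : ℝ) ^ N ≤ N.factorial * 3 ^ N := by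
  have h := Real.pow_div_factorial_le_exp (N : ℝ) (by positivity) N
  rw [div_le_iff₀ (by positivity)] at h
  refine h.trans ?_
  rw [mul_comm]
  refine mul_le_mul_of_nonneg_left ?_ (by positivity)
  rw [← mul_one (N : ℝ), Real.exp_nat_mul]
  exact pow_le_pow_left₀ (Real.exp_pos 1).le Real.exp_one_lt_three.le N

variable {A : Type*} [AddGroup A]

open Classical in
theorem card_filter_add_mem_le {N : ℕ} (Y : Finset A) (x' : Fin N → A) {c : ℝ}
    (hc : ∀ a, ((Finset.univ.filter fun k => x' k = a).card : ℝ) ≤ c) (a : A) :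
    ((Finset.univ.filter fun j => a + x' j ∈ Y).card : ℝ) ≤ Y.card * c := by
  have hsub : (Finset.univ.filter fun j => a + x' j ∈ Y) ⊆
      Y.biUnion fun y => Finset.univ.filter fun j => x' j = -a + y := by
    intro j hj
    simp only [Finset.mem_filter, Finset.mem_univ, true_and] at hj
    simp only [Finset.mem_biUnion, Finset.mem_filter, Finset.mem_univ, true_and]
    exact ⟨_, hj, by simp⟩
  have h1 := (Finset.card_le_card hsub).trans Finset.card_biUnion_le
  calc ((Finset.univ.filter fun j => a + x' j ∈ Y).card : ℝ)
      ≤ ∑ y ∈ Y, ((Finset.univ.filter fun j => x' j = -a + y).card : ℝ) := by exact_mod_cast h1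
    _ ≤ ∑ _y ∈ Y, c := Finset.sum_le_sum fun y _ => hc _
    _ = Y.card * c := by rw [Finset.sum_const, nsmul_eq_mul]

open Classical in
/-- A bound for the number of permutations that match two labellings up to differences outside
`Y` at `m` places at most. -/
theorem card_matching_perms_le {N : ℕ} (Y : Finset A) (x x' : Fin N → A) (m : ℕ) {c : ℝ}
    (hc : ∀ a, ((Finset.univ.filter fun k => x' k = a).card : ℝ) ≤ c) (hm : m ≤ N)
    (hqN : Y.card * c ≤ N) :
    ((Finset.univ.filter fun π : Equiv.Perm (Fin N) =>
      (Finset.univ.filter fun k => x k + x' (π k) ∉ Y).card ≤ m).card : ℝ) ≤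
        2 ^ N * (N ^ m * (Y.card * c) ^ (N - m)) := by
  set q : ℝ := Y.card * c
  have hq0 : 0 ≤ q := (Nat.cast_nonneg _).trans (card_filter_add_mem_le Y x' hc 0)
  -- `B` is the set of exceptional places and `D B k` the set of allowed images of `k`; injectivity
  -- of the permutation is forgotten.
  let D : Finset (Fin N) → Fin N → Finset (Fin N) := fun B k =>
    if k ∈ B then Finset.univ else Finset.univ.filter fun j => x k + x' j ∈ Y
  let small : Finset (Finset (Fin N)) := Finset.univ.filter fun B => B.card ≤ m
  have hcover : (Finset.univ.filter fun π : Equiv.Perm (Fin N) =>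
      (Finset.univ.filter fun k => x k + x' (π k) ∉ Y).card ≤ m).card ≤
        (small.biUnion fun B => Fintype.piFinset (D B)).card := by
    refine Finset.card_le_card_of_injOn (fun π k => π k) (fun π hπ => ?_) fun π _ π' _ h =>
      Equiv.ext (congrFun h)
    simp only [Finset.coe_filter, Finset.mem_univ, true_and, Set.mem_ofPred_eq] at hπ
    simp only [Finset.coe_biUnion, Set.mem_iUnion, Finset.mem_coe]
    refine ⟨_, Finset.mem_filter.mpr ⟨Finset.mem_univ _, hπ⟩, Fintype.mem_piFinset.mpr fun k => ?_⟩
    simp only [D]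
    split_ifs with h
    · exact Finset.mem_univ _
    · simpa using h
  have hD : ∀ B ∈ small, ((Fintype.piFinset (D B)).card : ℝ) ≤ N ^ m * q ^ (N - m) := by
    intro B hB
    have hB' : B.card ≤ m := (Finset.mem_filter.mp hB).2
    rw [Fintype.card_piFinset, Nat.cast_prod, ← Finset.prod_mul_prod_compl B]
    have h1 : ∏ k ∈ B, ((D B k).card : ℝ) = (N : ℝ) ^ B.card := by
      rw [← Finset.prod_const]
      exact Finset.prod_congr rfl fun k hk => by
        simp only [D, if_pos hk, Finset.card_univ, Fintype.card_fin]
    have h2 : ∏ k ∈ Bᶜ, ((D B k).card : ℝ) ≤ q ^ (N - B.card) := by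
      have hcard : N - B.card = Bᶜ.card := by rw [Finset.card_compl, Fintype.card_fin]
      rw [hcard, ← Finset.prod_const]
      refine Finset.prod_le_prod (fun _ _ => by positivity) fun k hk => ?_
      simp only [D, if_neg (Finset.mem_compl.mp hk)]
      exact card_filter_add_mem_le Y x' hc _
    rw [h1]
    refine (mul_le_mul_of_nonneg_left h2 (by positivity)).trans ?_
    -- As `q ≤ N`, raising the number of exceptional places to `m` only weakens the bound.
    have e1 : N - B.card = (m - B.card) + (N - m) := by omega
    have e2 : m = B.card + (m - B.card) := by omega
    calc (N : ℝ) ^ B.card * q ^ (N - B.card)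
        = (N : ℝ) ^ B.card * q ^ (m - B.card) * q ^ (N - m) := by rw [e1, pow_add, mul_assoc]
      _ ≤ (N : ℝ) ^ B.card * (N : ℝ) ^ (m - B.card) * q ^ (N - m) :=
          mul_le_mul_of_nonneg_right (mul_le_mul_of_nonneg_left (pow_le_pow_left₀ hq0 hqN _)
            (by positivity)) (pow_nonneg hq0 _)
      _ = (N : ℝ) ^ m * q ^ (N - m) := by rw [← pow_add, ← e2]
  calc _ ≤ ((small.biUnion fun B => Fintype.piFinset (D B)).card : ℝ) := by exact_mod_cast hcover
    _ ≤ ∑ B ∈ small, ((Fintype.piFinset (D B)).card : ℝ) := by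
        exact_mod_cast Finset.card_biUnion_le
    _ ≤ ∑ _B ∈ small, (N : ℝ) ^ m * q ^ (N - m) := Finset.sum_le_sum hD
    _ ≤ 2 ^ N * (N ^ m * q ^ (N - m)) := by
        rw [Finset.sum_const, nsmul_eq_mul]
        refine mul_le_mul_of_nonneg_right ?_ (mul_nonneg (by positivity) (pow_nonneg hq0 _))
        have : small.card ≤ 2 ^ N := (Finset.card_le_univ _).trans_eq (by
          rw [Fintype.card_finset, Fintype.card_fin])
        exact_mod_cast this

open Classical in
/-- If all lifts of a graph have nearly equidistributed labellings that are nearly constant along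
the edges in `F`, then the number of lifts is bounded in terms of the number of labellings. -/
theorem factorial_pow_le {V E : Type*} [Fintype V] [Fintype A] (src tgt : E → V)
    (Y : Finset A) (F : Finset E) (N m : ℕ) (hm : m ≤ N) {c : ℝ} (hc : 0 ≤ c)
    (hqN : Y.card * c ≤ N)
    (hlab : ∀ π : E → Equiv.Perm (Fin N), ∃ X : V → Fin N → A,
      (∀ v a, ((Finset.univ.filter fun k => X v k = a).card : ℝ) ≤ c) ∧
      ∀ f ∈ F, (Finset.univ.filter fun k => X (src f) k + X (tgt f) (π f k) ∉ Y).card ≤ m) :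
    (N.factorial : ℝ) ^ F.card ≤ (Fintype.card A : ℝ) ^ (N * Fintype.card V) *
      (2 ^ N * (N ^ m * (Y.card * c) ^ (N - m))) ^ F.card := by
  let good : Finset (V → Fin N → A) := Finset.univ.filter fun X =>
    ∀ v a, ((Finset.univ.filter fun k => X v k = a).card : ℝ) ≤ c
  let D : (V → Fin N → A) → F → Finset (Equiv.Perm (Fin N)) := fun X f =>
    Finset.univ.filter fun π =>
      (Finset.univ.filter fun k => X (src f) k + X (tgt f) (π k) ∉ Y).card ≤ m
  have hcover : (Finset.univ : Finset (F → Equiv.Perm (Fin N))) ⊆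
      good.biUnion fun X => Fintype.piFinset (D X) := by
    intro π _
    obtain ⟨X, hX, hX'⟩ := hlab fun f => if h : f ∈ F then π ⟨f, h⟩ else 1
    refine Finset.mem_biUnion.mpr ⟨X, Finset.mem_filter.mpr ⟨Finset.mem_univ _, hX⟩,
      Fintype.mem_piFinset.mpr fun f => Finset.mem_filter.mpr ⟨Finset.mem_univ _, ?_⟩⟩
    have := hX' f f.2
    rwa [dif_pos f.2] at this
  have h1 := (Finset.card_le_card hcover).trans Finset.card_biUnion_le
  rw [Finset.card_univ, Fintype.card_fun, Fintype.card_perm, Fintype.card_fin,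
    Fintype.card_coe] at h1
  calc (N.factorial : ℝ) ^ F.card
      ≤ ∑ X ∈ good, ((Fintype.piFinset (D X)).card : ℝ) := by exact_mod_cast h1
    _ ≤ ∑ _X ∈ good, (2 ^ N * (N ^ m * (Y.card * c) ^ (N - m))) ^ F.card := by
        refine Finset.sum_le_sum fun X hX => ?_
        rw [Fintype.card_piFinset, Nat.cast_prod]
        refine (Finset.prod_le_prod (fun _ _ => by positivity) fun f _ => ?_).trans_eq
          (?_ : ∏ _f : F, (2 ^ N * (N ^ m * (Y.card * c) ^ (N - m))) = _)
        · refine (le_of_eq ?_).trans (card_matching_perms_le Y (X (src f)) (X (tgt f)) m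
            ((Finset.mem_filter.mp hX).2 (tgt f)) hm hqN)
          simp only [D]
        · rw [Finset.prod_const, Finset.card_univ, Fintype.card_coe]
    _ ≤ _ := by
        rw [Finset.sum_const, nsmul_eq_mul]
        have h2 : good.card ≤ Fintype.card A ^ (N * Fintype.card V) := by
          refine (Finset.card_le_univ _).trans_eq ?_
          rw [Fintype.card_fun, Fintype.card_fun, Fintype.card_fin, pow_mul]
        refine mul_le_mul_of_nonneg_right ?_ (by positivity)
        exact_mod_cast h2

/-- By Stirling's bound the powers of the number `16 * m` of sheets cancel, and an `m`-th root
removes `m`. In the base `6`, the factor `3` comes from the factorial and `2` from the choice of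
exceptional places. -/
theorem pow_le_of_factorial_pow_le {a y : ℝ} (ha : 0 < a) (hy : 0 ≤ y) (m s t : ℕ) (hm : 0 < m)
    (h : (((16 * m).factorial : ℕ) : ℝ) ^ s ≤ a ^ (16 * m * t) *
      (2 ^ (16 * m) * (((16 * m : ℕ) : ℝ) ^ m *
        (y * (2 * (16 * m : ℕ) / a)) ^ (16 * m - m))) ^ s) :
    a ^ (15 * s) ≤ a ^ (16 * t) * (6 ^ (16 * s) * (2 * y) ^ (15 * s)) := by
  set n : ℝ := ((16 * m : ℕ) : ℝ) with hn
  have hn0 : 0 < n := by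
    rw [hn]
    exact_mod_cast (by omega)
  have hsub : 16 * m - m = 15 * m := by omega
  rw [hsub] at h
  have h1 := pow_le_factorial_mul (16 * m)
  rw [← hn] at h1
  have h2 : (n ^ (16 * m)) ^ s ≤ (n ^ (16 * m)) ^ s *
      (a ^ (16 * t) * (6 ^ (16 * s) * (2 * y / a) ^ (15 * s))) ^ m := by
    calc (n ^ (16 * m)) ^ s ≤ (((16 * m).factorial : ℕ) * 3 ^ (16 * m)) ^ s := by gcongr
      _ = (((16 * m).factorial : ℕ) : ℝ) ^ s * (3 ^ (16 * m)) ^ s := mul_pow _ _ _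
      _ ≤ a ^ (16 * m * t) * (2 ^ (16 * m) * (n ^ m * (y * (2 * n / a)) ^ (15 * m))) ^ s *
          (3 ^ (16 * m)) ^ s := by gcongr
      _ = _ := by
        have e1 : y * (2 * n / a) = n * (2 * y / a) := by ring
        have e2 : (6 : ℝ) = 2 * 3 := by norm_num
        rw [e1, e2]
        simp only [mul_pow, ← pow_mul]
        have e3 : n ^ (16 * m * s) = n ^ (m * s) * n ^ (15 * m * s) := by
          rw [← pow_add]
          congr 1
          ring
        rw [e3]
        ring
  have h3 : 1 ≤ (a ^ (16 * t) * (6 ^ (16 * s) * (2 * y / a) ^ (15 * s))) ^ m :=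
    le_of_mul_le_mul_left (by simpa using h2) (by positivity : 0 < (n ^ (16 * m)) ^ s)
  have h4 : 1 ≤ a ^ (16 * t) * (6 ^ (16 * s) * (2 * y / a) ^ (15 * s)) := by
    by_contra! hlt
    exact absurd h3 (not_le.mpr (pow_lt_one₀ (by positivity) hlt hm.ne'))
  have h5 := mul_le_mul_of_nonneg_left h4 (by positivity : 0 ≤ a ^ (15 * s))
  rw [mul_one] at h5
  refine h5.trans_eq ?_
  rw [div_pow]
  field_simp

/-- Give each zero the weight 256. The total weight is `257 ^ n`, and a light cochain weighs at
least `256 ^ (n - k)`. The constants work because `257 ^ 128 ≤ 2 * 256 ^ 128` and `256 ^ (128 * k) =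
2 ^ (1024 * k)`. -/
theorem light_card_pow_le {E : Type*} [Fintype E] [DecidableEq E] (k : ℕ)
    (hk : 1024 * k ≤ Fintype.card E) :
    ((Finset.univ : Finset (E → Fin 2)).filter fun y =>
      (Finset.univ.filter fun e => y e ≠ 0).card ≤ k).card ^ 64 ≤ 2 ^ Fintype.card E := by
  set n := Fintype.card E
  set S := (Finset.univ : Finset (E → Fin 2)).filter fun y =>
      (Finset.univ.filter fun e => y e ≠ 0).card ≤ k
  have htot : ∑ y : E → Fin 2, ∏ e, (if y e = 0 then (256 : ℝ) else 1) = 257 ^ n := by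
    have := Finset.prod_univ_sum (fun _ : E => (Finset.univ : Finset (Fin 2)))
      (fun _ a => if a = 0 then (256 : ℝ) else 1)
    rw [Fintype.piFinset_univ] at this
    rw [← this]
    simp only [Fin.sum_univ_two]
    rw [Finset.prod_const, Finset.card_univ]
    norm_num [n]
  have hle : (S.card : ℝ) * 256 ^ (n - k) ≤ 257 ^ n := by
    rw [← htot, ← nsmul_eq_mul, ← Finset.sum_const]
    refine (Finset.sum_le_sum fun y hy => ?_).trans
      (Finset.sum_le_univ_sum_of_nonneg fun y => Finset.prod_nonneg fun e _ => by
        split_ifs <;> norm_num)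
    rw [Finset.prod_ite, Finset.prod_const, Finset.prod_const_one, mul_one]
    refine pow_le_pow_right₀ (by norm_num) ?_
    have h1 := Finset.card_filter_add_card_filter_not (s := (Finset.univ : Finset E))
      fun e => y e = 0
    have h2 : (Finset.univ.filter fun e => y e ≠ 0).card ≤ k := (Finset.mem_filter.mp hy).2
    rw [Finset.card_univ] at h1
    simp only [ne_eq] at h2
    omega
  have hle2 : (S.card : ℝ) * 256 ^ n ≤ 257 ^ n * 256 ^ k := by
    have hkn : n = (n - k) + k := by omega
    calc (S.card : ℝ) * 256 ^ n = S.card * 256 ^ (n - k) * 256 ^ k := by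
          rw [mul_assoc, ← pow_add, ← hkn]
      _ ≤ 257 ^ n * 256 ^ k := by gcongr
  have h128 : (S.card : ℝ) ^ 128 * (256 ^ 128) ^ n ≤ (2 ^ n) ^ 2 * (256 ^ 128) ^ n := by
    calc (S.card : ℝ) ^ 128 * (256 ^ 128) ^ n = (S.card * 256 ^ n) ^ 128 := by
          rw [mul_pow, ← pow_mul, ← pow_mul, mul_comm 128 n]
      _ ≤ (257 ^ n * 256 ^ k) ^ 128 := by gcongr
      _ = (257 ^ 128) ^ n * 2 ^ (1024 * k) := by
          rw [mul_pow, ← pow_mul, ← pow_mul, ← pow_mul, mul_comm 128 n,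
            show (256 : ℝ) = 2 ^ 8 by norm_num, ← pow_mul]
          congr 2
          ring
      _ ≤ (2 * 256 ^ 128) ^ n * 2 ^ n := by
          gcongr
          · norm_num
          · norm_num
      _ = (2 ^ n) ^ 2 * (256 ^ 128) ^ n := by
          rw [mul_pow]
          ring
  have h := le_of_mul_le_mul_right h128 (by positivity)
  have h' : ((S.card : ℝ) ^ 64) ^ 2 ≤ (2 ^ n) ^ 2 := by
    rw [← pow_mul]
    exact h
  exact_mod_cast (pow_le_pow_iff_left₀ (by positivity) (by positivity) two_ne_zero).mp h'

/-- The numerical contradiction between the number of lifts and the number of labellings. -/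
theorem not_pow_le {a y : ℝ} {n s t : ℕ} (ha : 0 < a) (hy : 0 < y) (hn : 100 ≤ n)
    (hs : 7 * n ≤ 8 * s) (hsn : s ≤ n) (ht : 3 * t ≤ 2 * n) (han : 2 ^ n ≤ a ^ 3)
    (hyn : y ^ 64 ≤ 2 ^ n) :
    2 * y ≤ a ∧ ¬ a ^ (15 * s) ≤ a ^ (16 * t) * (6 ^ (16 * s) * (2 * y) ^ (15 * s)) := by
  have hlog2 : Real.log 2 < 0.7 := Real.log_two_lt_d9.trans (by norm_num)
  have hlog2' : 0.69 < Real.log 2 := lt_trans (by norm_num) Real.log_two_gt_d9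
  have hlog6 : Real.log 6 < 1.85 := by
    rw [show (6 : ℝ) = 2 * 3 by norm_num, Real.log_mul (by norm_num) (by norm_num)]
    have : Real.log 3 < 1.15 := by
      rw [Real.log_lt_iff_lt_exp (by norm_num)]
      have h1 := Real.exp_one_gt_d9
      have h2 : (0.15 : ℝ) + 1 ≤ Real.exp 0.15 := Real.add_one_le_exp _
      rw [show (1.15 : ℝ) = 1 + 0.15 by norm_num, Real.exp_add]
      nlinarith
    linarith
  have hA : n * Real.log 2 ≤ 3 * Real.log a := by
    have := Real.log_le_log (by positivity) han
    rwa [Real.log_pow, Real.log_pow] at this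
  have hB : 64 * Real.log y ≤ n * Real.log 2 := by
    have := Real.log_le_log (by positivity) hyn
    rwa [Real.log_pow, Real.log_pow] at this
  have hn' : (100 : ℝ) ≤ n := by exact_mod_cast hn
  have hs' : 7 * (n : ℝ) ≤ 8 * s := by exact_mod_cast hs
  have hsn' : (s : ℝ) ≤ n := by exact_mod_cast hsn
  have ht' : 3 * (t : ℝ) ≤ 2 * n := by exact_mod_cast ht
  -- `100 * 0.69 / 3 = 23`.
  have hL : 23 ≤ Real.log a := by nlinarith
  constructor
  · rw [← Real.log_le_log_iff (by positivity) ha, Real.log_mul (by norm_num) hy.ne']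
    linarith
  · intro h
    have h1 := Real.log_le_log (by positivity) h
    rw [Real.log_mul (by positivity) (by positivity), Real.log_mul (by positivity) (by positivity),
      Real.log_pow, Real.log_pow, Real.log_pow, Real.log_pow,
      Real.log_mul (by norm_num) hy.ne'] at h1
    push_cast at h1
    have h2 : (s : ℝ) * (15 * Real.log a - 16 * Real.log 6 - 15 * (Real.log 2 + Real.log y)) ≤
        16 * t * Real.log a := by linarith
    -- `15 * log y ≤ 15 / 64 * n * log 2 ≤ 45 / 64 * log a`.
    have h3 : 15 * Real.log a - 45 / 64 * Real.log a - 16 * 1.85 - 15 * 0.7 ≤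
        15 * Real.log a - 16 * Real.log 6 - 15 * (Real.log 2 + Real.log y) := by linarith
    have h4 : 0 ≤ 15 * Real.log a - 45 / 64 * Real.log a - 16 * 1.85 - 15 * 0.7 := by linarith
    have h5 : (7 / 8 * n : ℝ) * (15 * Real.log a - 45 / 64 * Real.log a - 16 * 1.85 - 15 * 0.7) ≤
        s * (15 * Real.log a - 16 * Real.log 6 - 15 * (Real.log 2 + Real.log y)) :=
      mul_le_mul (by linarith) h3 h4 (by positivity)
    have h6 : 16 * (t : ℝ) * Real.log a ≤ 16 * (2 / 3 * n) * Real.log a :=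
      mul_le_mul_of_nonneg_right (by linarith) (by linarith)
    -- The coefficient of `n * log a` exceeds 12.5 on the left and is `32 / 3` on the right; for
    -- `log a ≥ 23` the gap outweighs the constants.
    have h7 := h5.trans (h2.trans h6)
    nlinarith

end Counting

/-! ### No low-energy trivial states -/

section Main

open SimpleGraph

variable {V : Type*} [Fintype V] {G : SimpleGraph V} [DecidableRel G.Adj]

theorem three_mul_card_le (hdeg : ∀ v, 3 ≤ G.degree v) :
    3 * Fintype.card V ≤ 2 * Fintype.card G.edgeSet := by
  have h1 := G.sum_degrees_eq_twice_card_edges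
  have h2 := Finset.card_nsmul_le_sum Finset.univ (fun v => G.degree v) 3 fun v _ => hdeg v
  rw [h1, Finset.card_univ, edgeFinset_card, smul_eq_mul] at h2
  linarith

variable [DecidableEq V]

/-- There are at most `2 ^ |V|` coboundaries, and `|V|` is at most two thirds of the number of
edges. -/
theorem two_pow_le_card_edgeClass_pow
    (hV : 3 * Fintype.card V ≤ 2 * Fintype.card G.edgeSet) :
    2 ^ Fintype.card G.edgeSet ≤ Nat.card (EdgeClass G) ^ 3 := by
  have h1 := AddSubgroup.card_eq_card_quotient_mul_card_addSubgroup (edgeCoboundary G).range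
  rw [Nat.card_eq_fintype_card, Fintype.card_fun, Fintype.card_fin] at h1
  have h2 : Nat.card (edgeCoboundary G).range ≤ 2 ^ Fintype.card V := by
    refine (Nat.card_le_card_of_surjective (edgeCoboundary G).rangeRestrict
      (edgeCoboundary G).rangeRestrict_surjective).trans_eq ?_
    rw [Nat.card_eq_fintype_card, Fintype.card_fun, Fintype.card_fin]
  set n := Fintype.card G.edgeSet
  set M := Nat.card (EdgeClass G)
  have h3 : 2 ^ n ≤ M * 2 ^ Fintype.card V := by
    rw [h1]
    exact Nat.mul_le_mul_left _ h2
  have h4 : 2 ^ n * 2 ^ (2 * n) ≤ M ^ 3 * 2 ^ (2 * n) := by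
    calc 2 ^ n * 2 ^ (2 * n) = (2 ^ n) ^ 3 := by ring
      _ ≤ (M * 2 ^ Fintype.card V) ^ 3 := Nat.pow_le_pow_left h3 3
      _ = M ^ 3 * 2 ^ (3 * Fintype.card V) := by ring
      _ ≤ M ^ 3 * 2 ^ (2 * n) := Nat.mul_le_mul_left _ (Nat.pow_le_pow_right two_pos hV)
  exact Nat.le_of_mul_le_mul_right h4 (by positivity)

theorem card_lightClasses_pow_le {k : ℕ} (hk : 1024 * k ≤ Fintype.card G.edgeSet) :
    (lightClasses G k).card ^ 64 ≤ 2 ^ Fintype.card G.edgeSet := by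
  classical
  exact (Nat.pow_le_pow_left Finset.card_image_le 64).trans (light_card_pow_le k hk)

theorem lightClasses_card_pos (k : ℕ) : 0 < (lightClasses G k).card := by
  classical
  exact Finset.card_pos.mpr ⟨QuotientAddGroup.mk 0,
    Finset.mem_image_of_mem _ (Finset.mem_filter.mpr ⟨Finset.mem_univ _, by simp⟩)⟩

open Classical in
/-- In a state of low energy, the cohomology classes at the ends of most edges nearly agree. -/
theorem card_good_edges {ψ : SpinSpace (OneCell G)} (hψ : ‖ψ‖ = 1) {k : ℕ}
    (hk : Fintype.card G.edgeSet ≤ 1024 * (k + 1)) (hn : 0 < Fintype.card G.edgeSet)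
    (henergy : (inner ℂ ψ ((plaquetteHamiltonian G).app ψ)).re
      < -(1 - 1 / 2 ^ 17) * (Fintype.card (TwoCell G) : ℝ)) :
    7 * Fintype.card G.edgeSet ≤ 8 * (Finset.univ.filter fun f : G.edgeSet =>
      prob ψ.ofLp {σ | edgeClass (Quot.out (f : Sym2 V)).1 σ +
        edgeClass (Quot.out (f : Sym2 V)).2 σ ∉ lightClasses G k} ≤ 1 / 32).card := by
  set n := Fintype.card G.edgeSet
  set p : G.edgeSet → ℝ := fun f => prob ψ.ofLp {σ | edgeClass (Quot.out (f : Sym2 V)).1 σ +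
        edgeClass (Quot.out (f : Sym2 V)).2 σ ∉ lightClasses G k}
  rw [re_inner_plaquetteHamiltonian ψ hψ, Fintype.card_prod, Fintype.sum_prod_type,
    Finset.sum_comm] at henergy
  have h1 : ∑ f, (k + 1 : ℝ) * p f ≤ ∑ f, ∑ e, prob ψ.ofLp {σ | flux σ (e, f) ≠ 0} :=
    Finset.sum_le_sum fun f _ => prob_notMem_lightClasses ψ k f (edge_eq_out f)
  rw [← Finset.mul_sum] at h1
  have hk' : (n : ℝ) ≤ 1024 * (k + 1) := by exact_mod_cast hk
  have hn' : (0 : ℝ) < n := by exact_mod_cast hn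
  have hp0 : 0 ≤ ∑ f, p f := Finset.sum_nonneg fun f _ => prob_nonneg _ _
  have h2 : (n / 1024) * ∑ f, p f ≤ (k + 1 : ℝ) * ∑ f, p f :=
    mul_le_mul_of_nonneg_right (by linarith) hp0
  push_cast at henergy
  -- The energy bound makes the expected number of violated plaquettes less than `n ^ 2 / 2 ^ 18`.
  -- Dividing by `n / 1024` bounds the sum of the `p f` by `n / 256`, so at most `n / 8` edges
  -- exceed `1 / 32`.
  have h3 : n * ∑ f, p f ≤ n * (n / 256) := by
    have : 2 * ((n / 1024) * ∑ f, p f) ≤ 1 / 2 ^ 17 * (n * n) := by linarith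
    linarith
  have h4 : ∑ f, p f ≤ n / 256 := le_of_mul_le_mul_left h3 hn'
  have h5 : ((Finset.univ.filter fun f => ¬ p f ≤ 1 / 32).card : ℝ) * (1 / 32) ≤ n / 256 := by
    rw [← nsmul_eq_mul]
    refine (Finset.card_nsmul_le_sum _ p _ fun f hf => ?_).trans
      ((Finset.sum_le_univ_sum_of_nonneg fun f => prob_nonneg _ _).trans h4)
    exact (not_le.mp (Finset.mem_filter.mp hf).2).le
  have h6 := Finset.card_filter_add_card_filter_not (s := (Finset.univ : Finset G.edgeSet))
    fun f => p f ≤ 1 / 32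
  rw [Finset.card_univ] at h6
  have h7 : 8 * (Finset.univ.filter fun f => ¬ p f ≤ 1 / 32).card ≤ n := by
    have : (8 : ℝ) * (Finset.univ.filter fun f => ¬ p f ≤ 1 / 32).card ≤ n := by linarith
    exact_mod_cast this
  have h8 : 7 * n ≤ 8 * (Finset.univ.filter fun f => p f ≤ 1 / 32).card := by omega
  convert h8

theorem not_exists_trivial_state (hG : G.Connected) (hdeg : ∀ v, 3 ≤ G.degree v) {R : ℕ}
    (hg : ((12 * R + 5 : ℕ) : ℕ∞) ≤ G.egirth) (hcard : 100 ≤ Fintype.card V)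
    {ψ : SpinSpace (OneCell G)} (hψ : IsTrivialState (cellGraph G) R ψ)
    (hA : ∀ s : ZeroCell G, (vertexTerm G s).app ψ = ψ) :
    ¬ (inner ℂ ψ ((plaquetteHamiltonian G).app ψ)).re
      < -(1 - 1 / 2 ^ 17) * (Fintype.card (TwoCell G) : ℝ) := by
  classical
  intro henergy
  have hinv := norm_add_rowShift hG hg hψ hA
  have hVn := three_mul_card_le hdeg
  have hMn := two_pow_le_card_edgeClass_pow hVn
  set n := Fintype.card G.edgeSet with hn
  have hYn := card_lightClasses_pow_le (G := G) (k := n / 1024) (by omega)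
  have hY0 := lightClasses_card_pos (G := G) (n / 1024)
  have hFn := card_good_edges hψ.1 (k := n / 1024) (by omega) (by omega) henergy
  set Y := lightClasses G (n / 1024)
  set F := Finset.univ.filter fun f : G.edgeSet =>
      prob ψ.ofLp {σ | edgeClass (Quot.out (f : Sym2 V)).1 σ +
        edgeClass (Quot.out (f : Sym2 V)).2 σ ∉ Y} ≤ 1 / 32
  have hM : Fintype.card (EdgeClass G) = Nat.card (EdgeClass G) :=
    Nat.card_eq_fintype_card.symm
  set M := Nat.card (EdgeClass G)
  have hMpos : 0 < M := Nat.card_pos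
  have hM0 : (0 : ℝ) < M := by exact_mod_cast hMpos
  obtain ⟨hYM, hcontra⟩ := not_pow_le (a := M) (y := Y.card) (n := n) (s := F.card)
    (t := Fintype.card V) hM0 (by exact_mod_cast hY0) (by omega) hFn (Finset.card_le_univ F) hVn
    (by exact_mod_cast hMn) (by exact_mod_cast hYn)
  -- With `16 * m` sheets a sixteenth of them is exactly `m`, and the number of sheets is large
  -- enough for `exists_labelling`.
  set m := Fintype.card V * M ^ 2 + 32 * F.card + 1 with hm
  have hm0 : 0 < m := by omega
  refine hcontra (pow_le_of_factorial_pow_le hM0 (by positivity) m F.card (Fintype.card V) hm0 ?_)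
  have hcount := factorial_pow_le (fun f : G.edgeSet => (Quot.out (f : Sym2 V)).1)
    (fun f : G.edgeSet => (Quot.out (f : Sym2 V)).2) Y F (16 * m) m (by omega)
    (c := 2 * (16 * m : ℕ) / M) (by positivity) ?_ fun π => ?_
  · rw [hM] at hcount
    exact hcount
  · rw [← mul_div_assoc, div_le_iff₀ hM0]
    have := mul_le_mul_of_nonneg_right hYM (Nat.cast_nonneg (α := ℝ) (16 * m))
    linarith
  · obtain ⟨X, hX, hX'⟩ := exists_labelling hG hg hψ hinv Y F
      (fun f hf => (Finset.mem_filter.mp hf).2) (N := 16 * m) (by change _ * M ^ 2 + _ < _; omega) π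
    refine ⟨X, fun v a => ?_, fun f hf => ?_⟩
    · rw [le_div_iff₀ hM0, mul_comm]
      have := hX v a
      refine le_trans (le_of_eq ?_) (by exact_mod_cast this : ((M * _ : ℕ) : ℝ) ≤ _)
      push_cast
      congr!
    · have := hX' f hf
      refine le_trans (le_of_eq ?_) (Nat.le_of_mul_le_mul_left this (by norm_num))
      congr!

end Main

theorem mainTheorem1 {ι : Type*} {V : ι → Type*}
    [∀ n, Fintype (V n)] [∀ n, DecidableEq (V n)]
    (G : ∀ n, SimpleGraph (V n)) [∀ n, DecidableRel (G n).Adj]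
    -- a family of connected graphs of bounded degree, all degrees being at least three
    (d : ℕ)
    (hconn : ∀ n, (G n).Connected)
    (hdeg : ∀ n (v : V n), 3 ≤ (G n).degree v ∧ (G n).degree v ≤ d)
    -- the girth diverges with the number of vertices
    (hgirth : ∀ g : ℕ, ∃ N₀ : ℕ, ∀ n, N₀ ≤ Fintype.card (V n) → (g : ℕ∞) ≤ (G n).egirth) :
    ∃ ε : ℝ, 0 < ε ∧ ∀ R : ℕ, ∃ N₀ : ℕ, ∀ n, N₀ ≤ Fintype.card (V n) →
      ¬ ∃ ψ : SpinSpace (OneCell (G n)),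
        ‖ψ‖ = 1 ∧
        IsTrivialState (cellGraph (G n)) R ψ ∧
        (∀ s : ZeroCell (G n), (vertexTerm (G n) s).app ψ = ψ) ∧
        (inner ℂ ψ ((plaquetteHamiltonian (G n)).app ψ)).re
          < -(1 - ε) * (Fintype.card (TwoCell (G n)) : ℝ) := by
  refine ⟨1 / 2 ^ 17, by positivity, fun R => ?_⟩
  obtain ⟨N₀, hN₀⟩ := hgirth (12 * R + 5)
  -- A hundred vertices force at least a hundred edges, as `not_pow_le` requires.
  refine ⟨max N₀ 100, fun n hn => ?_⟩
  rintro ⟨ψ, -, hψ, hA, henergy⟩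
  exact not_exists_trivial_state (hconn n) (fun v => (hdeg n v).1)
    (hN₀ n ((le_max_left _ _).trans hn)) ((le_max_right _ _).trans hn) hψ hA henergy
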